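/- **The satellite system.** Let $\Lambda=(0,+\infty)\times(0,1)\times\mathbf R$, with points $I=(I^P,I^E,I^Y)=(P,E,Y)$, and for $\vartheta\in\mathbf R/2\pi\mathbf Z$ put $$f^P=\tfrac{6\pi}{P}\big(E\sin(\vartheta+Y)+2\sin 2\vartheta+E\sin(3\vartheta-Y)\big),$$ $$f^E=\tfrac{3\pi}{8P^2}\big(E^2\sin(\vartheta-3Y)+(8+2E^2)\sin(\vartheta-Y)+(4+11E^2)\sin(\vartheta+Y)+8E\sin(2\vartheta-2Y)+40E\sin2\vartheta+2E^2\sin(3\vartheta-3Y)+(28+17E^2)\sin(3\vartheta-Y)+24E\sin(4\vartheta-2Y)+5E^2\sin(5\vartheta-3Y)\big),$$ $$f^Y=-\tfrac{3\pi}{P^2}-\tfrac{3\pi}{8EP^2}\big(E^2\cos(\vartheta-3Y)+(8+6E^2)\cos(\vartheta-Y)-(4-7E^2)\cos(\vartheta+Y)+8E\cos(2\vartheta-2Y)+24E\cos2\vartheta+2E^2\cos(3\vartheta-3Y)+(28+11E^2)\cos(3\vartheta-Y)+24E\cos(4\vartheta-2Y)+5E^2\cos(5\vartheta-3Y)\big).$$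 Fix $I_0=(P_0,E_0,Y_0)\in\Lambda$, $\varepsilon>0$, $0<U<+\infty$. The polar $J_2$ problem, with the orbit counter $t$ as time, is $$\frac{d\mathtt I}{dt}=\varepsilon f(\mathtt I,[2\pi t]),\qquad \mathtt I(0)=I_0,\qquad \mathtt I=(\mathtt P,\mathtt E,\mathtt Y)\in\Lambda.\tag{1}$$ **Auxiliary functions.** For a function $g(I,\vartheta)$ let $\overline g(I)=\frac1{2\pi}\int_0^{2\pi}g(I,\vartheta)\,d\vartheta$. Let $z(I,\vartheta)=\frac1{2\pi}\int_0^\vartheta (f(I,\vartheta')-\overline f(I))\,d\vartheta'$, $s=z-\overline z$, $p=\frac{\partial s}{\partial I}f$ and $\mathtt J(\tau)=(P_0,E_0,Y_0-3\pi\tau/P_0^2)$. Let $\mathtt R$ (matrix valued) and $\mathtt K$ (vector valued) solve on $[0,U)$ $$\frac{d\mathtt R}{d\tau}=\frac{\partial\overline f}{\partial I}(\mathtt J)\,\mathtt R,\quad \mathtt R(0)=1;\qquad \frac{d\mathtt K}{d\tau}=\frac{\partial\overline f}{\partial I}(\mathtt J)\,\mathtt K+\overline p(\mathtt J),\quad \mathtt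 K(0)=0 .$$ Let $a_{(0)}=(a^P_{(0)},a^E_{(0)},a^Y_{(0)})$ be any $C^2$ function on $[0,U)$ with $$\big|\big(s(\mathtt J(\tau),\vartheta)-\mathtt R(\tau)s(I_0,0)-\mathtt K(\tau)\big)^i\big|\le a^i_{(0)}(\tau)\qquad(i=P,E,Y;\ \tau\in[0,U),\ \vartheta\in\mathbf R/2\pi\mathbf Z).\tag{2}$$ **Majorants.** For $r=(r^P,r^E,r^Y)$ put $P_\pm=P_0\pm r^P$, $E_\pm=E_0\pm r^E$ and (rows and columns ordered $P,E,Y$) $$(a^i_j)=\begin{pmatrix}\frac{3+4E_+}{P_-^2}&\frac4{P_-}&\frac{4E_+}{P_-}\\ \frac{32+45E_++32E_+^2}{4P_-^3}&\frac{45+64E_+}{8P_-^2}&\frac{16+15E_++20E_+^2}{4P_-^2}\\ \frac{32+33E_++29E_+^2}{4P_-^3E_-}&\frac{32+29E_+^2}{8P_-^2E_-^2}&\frac{32+30E_++37E_+^2}{8P_-^2E_-}\end{pmatrix},$$ $$b^P=\tfrac{54+112E_++33E_+^2}{8P_-^3},\qquad b^E=\tfrac{6112+10832E_++6940E_+^2+11372E_+^3+1441E_+^4}{512P_-^4E_-},$$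 $$b^Y=\tfrac{1}{256P_0^3E_-^2P_-^4}\big[P_0^3(3520+16384E_++9340E_+^2+8940E_+^3+1861E_+^4)+P_+^3(1152E_+^2+4608E_+^3)\big],$$ $$c^P=\tfrac{3\pi}{8P_-^5}(504+1024E_++713E_+^2+124E_+^3),$$ $$c^E=\tfrac{3\pi}{2048P_-^6E_-^2}\big[148736+738384E_++1062656E_+^2+1220344E_+^3+675146E_+^4+336591E_+^5+26855E_+^6\big],$$ $$c^Y=\tfrac{\pi}{1024P_0^3E_-^3P_-^6}\big[P_0^3(370944+2214336E_++5434752E_+^2+4927104E_+^3+2945040E_+^4+1225668E_+^5+147777E_+^6)+P_+^3(231936E_+^3+442368E_+^4+196608E_+^5)\big],$$ $$(d^i_j)=\begin{pmatrix}\frac{9\pi E_+^2}{2P_-^4}&\frac{3\pi E_+}{P_-^3}&\frac{3\pi E_+^2}{P_-^3}\\ \frac{3\pi E_+(10+E_+^2)}{P_-^5}&\frac{3\pi(10+3E_+^2)}{4P_-^4}&\frac{3\pi E_+(10+E_+^2)}{2P_-^4}\\ \frac{3\pi(74+35E_+^2)}{4P_-^5}&\frac{105\pi E_+}{8P_-^4}&\frac{15\pi(4+E_+^2)}{4P_-^4}\end{pmatrix},$$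 $e^Y_{PP}=18\pi/P_-^4$, and $e^i_{jk}=0$ otherwise. With summation over repeated indices, put $$\alpha^i(\tau,r)=a^i_{(0)}(\tau)+a^i_k(r)r^k+\varepsilon b^i(r),\qquad \gamma^i(r,\ell)=c^i(r)+d^i_j(r)\ell^j+\tfrac12e^i_{jk}(r)\ell^j\ell^k,\qquad R(\tau)=\begin{pmatrix}1&0&0\\0&1&0\\ \frac{6\pi}{P_0^3}\tau&0&1\end{pmatrix}.$$ **Theorem.** Suppose that $\ell_0\in\mathbf R^3$ satisfies $\alpha(0,\varepsilon\ell_0)=\ell_0$, and that $\mathfrak m,\mathfrak n:[0,U)\to\mathbf R^3$ solve the Cauchy problem $$\frac{d\mathfrak m}{d\tau}=R\,\gamma(\varepsilon\mathfrak n,\mathfrak n),\qquad \mathfrak m(0)=0,$$ $$\frac{d\mathfrak n}{d\tau}=\Big(1-\varepsilon\frac{\partial\alpha}{\partial r}(\cdot,\varepsilon\mathfrak n)\Big)^{-1}\Big(\frac{\partial\alpha}{\partial\tau}(\cdot,\varepsilon\mathfrak n)+\varepsilon R\,R\,\gamma(\varepsilon\mathfrak n,\mathfrak n)+\varepsilon\frac{dR}{d\tau}\mathfrak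 m\Big),\qquad \mathfrak n(0)=\ell_0,$$ on $[0,U)$, with the domain conditions $$0<\varepsilon\mathfrak n^P<P_0,\quad 0<\varepsilon\mathfrak n^E<\min(E_0,1-E_0),\quad \mathfrak n^Y>0,\quad \det\Big(1-\varepsilon\frac{\partial\alpha}{\partial r}(\cdot,\varepsilon\mathfrak n)\Big)>0 .$$ Then: 1. $\mathtt J$ is, on $[0,+\infty)$, the (unique) solution of the averaged system $d\mathtt J/d\tau=\overline f(\mathtt J)$, $\mathtt J(0)=I_0$, in $\Lambda$. 2. The (unique) solution $\mathtt I=(\mathtt P,\mathtt E,\mathtt Y)$ of (1) exists on $[0,U/\varepsilon)$, and for all $t\in[0,U/\varepsilon)$ $$|\mathtt P(t)-P_0|\le\varepsilon\,\mathfrak n^P(\varepsilon t),\qquad |\mathtt E(t)-E_0|\le\varepsilon\,\mathfrak n^E(\varepsilon t),\qquad |\mathtt Y(t)-\mathtt J^Y(\varepsilon t)|\le\varepsilon\,\mathfrak n^Y(\varepsilon t).$$ -/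

import Mathlib

noncomputable section

namespace PolarJ2

/-- Triples indexed by `P, E, Y`: the index `0` is `P`, the index `1` is `E`, the index `2` is `Y`. -/
abbrev Vec : Type := Fin 3 → ℝ

/-- `3 × 3` real matrices, rows and columns indexed by `P, E, Y`. -/
abbrev Mat : Type := Matrix (Fin 3) (Fin 3) ℝ

/-! ### Generic notions for periodic systems -/

/-- The Jacobian matrix `∂gⁱ/∂Iʲ` of `g` at `I`. -/
def jac (g : Vec → Vec) (I : Vec) : Mat :=
  Matrix.of fun i j => fderiv ℝ g I (Pi.single j 1) i

/-- Average over the angle. Functions on the torus `ℝ / 2πℤ` are represented by `2π`-periodic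
functions of a real angle. -/
def avg (g : Vec → ℝ → Vec) (I : Vec) : Vec :=
  fun i => 1 / (2 * Real.pi) * ∫ θ in (0 : ℝ)..(2 * Real.pi), g I θ i

/-- `z(I, ϑ) = (1/2π) ∫₀^ϑ (g(I, ϑ') - ḡ(I)) dϑ'`. -/
def zAux (g : Vec → ℝ → Vec) (I : Vec) (θ : ℝ) : Vec :=
  fun i => 1 / (2 * Real.pi) * ∫ θ' in (0 : ℝ)..θ, (g I θ' i - avg g I i)

/-- `s = z - z̄`: the solution of `g = ḡ + 2π ∂s/∂ϑ`, `s̄ = 0`. -/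
def sAux (g : Vec → ℝ → Vec) (I : Vec) (θ : ℝ) : Vec :=
  zAux g I θ - avg (zAux g) I

/-- `p = (∂s/∂I) g`. -/
def pAux (g : Vec → ℝ → Vec) (I : Vec) (θ : ℝ) : Vec :=
  (jac (fun I' => sAux g I' θ) I).mulVec (g I θ)

/-- `x` solves `x' = F(t, x)`, `x(0) = x₀` on `[0, T)`, with values in `D` (the derivative at `0` is
the right one). -/
def IsSolutionOn (D : Set Vec) (F : ℝ → Vec → Vec) (x₀ : Vec) (T : ℝ) (x : ℝ → Vec) : Prop :=
  x 0 = x₀ ∧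
    ∀ t ∈ Set.Ico 0 T, x t ∈ D ∧ HasDerivWithinAt x (F t (x t)) (Set.Ico 0 T) t

/-- `x` is the solution of the Cauchy problem on `[0, T)`: it is a solution, and every solution on
a subinterval `[0, T')` coincides there with `x`. -/
def IsTheSolutionOn (D : Set Vec) (F : ℝ → Vec → Vec) (x₀ : Vec) (T : ℝ) (x : ℝ → Vec) : Prop :=
  IsSolutionOn D F x₀ T x ∧
    ∀ T' ≤ T, ∀ y : ℝ → Vec, IsSolutionOn D F x₀ T' y → Set.EqOn y x (Set.Ico 0 T')

/-! ### The polar `J₂` problem in Kepler elements -/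

/-- The space of Kepler elements `Λ = (0, ∞) × (0, 1) × ℝ`. -/
def actionDomain : Set Vec := {I | 0 < I 0 ∧ 0 < I 1 ∧ I 1 < 1}

def fP (P E Y θ : ℝ) : ℝ :=
  6 * Real.pi / P *
    (E * Real.sin (θ + Y) + 2 * Real.sin (2 * θ) + E * Real.sin (3 * θ - Y))

def fE (P E Y θ : ℝ) : ℝ :=
  3 * Real.pi / (8 * P ^ 2) *
    (E ^ 2 * Real.sin (θ - 3 * Y) + (8 + 2 * E ^ 2) * Real.sin (θ - Y)
      + (4 + 11 * E ^ 2) * Real.sin (θ + Y) + 8 * E * Real.sin (2 * θ - 2 * Y)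
      + 40 * E * Real.sin (2 * θ) + 2 * E ^ 2 * Real.sin (3 * θ - 3 * Y)
      + (28 + 17 * E ^ 2) * Real.sin (3 * θ - Y) + 24 * E * Real.sin (4 * θ - 2 * Y)
      + 5 * E ^ 2 * Real.sin (5 * θ - 3 * Y))

def fY (P E Y θ : ℝ) : ℝ :=
  -(3 * Real.pi / P ^ 2) - 3 * Real.pi / (8 * E * P ^ 2) *
    (E ^ 2 * Real.cos (θ - 3 * Y) + (8 + 6 * E ^ 2) * Real.cos (θ - Y)
      - (4 - 7 * E ^ 2) * Real.cos (θ + Y) + 8 * E * Real.cos (2 * θ - 2 * Y)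
      + 24 * E * Real.cos (2 * θ) + 2 * E ^ 2 * Real.cos (3 * θ - 3 * Y)
      + (28 + 11 * E ^ 2) * Real.cos (3 * θ - Y) + 24 * E * Real.cos (4 * θ - 2 * Y)
      + 5 * E ^ 2 * Real.cos (5 * θ - 3 * Y))

/-- The perturbation `f(I, ϑ)` of the polar `J₂` problem. -/
def f (I : Vec) (θ : ℝ) : Vec :=
  ![fP (I 0) (I 1) (I 2) θ, fE (I 0) (I 1) (I 2) θ, fY (I 0) (I 1) (I 2) θ]

/-- The vector field `ε f(I, [2πt])` in the orbit counter `t`. -/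
def satelliteField (ε : ℝ) (t : ℝ) (I : Vec) : Vec := ε • f I (2 * Real.pi * t)

/-- The vector field `f̄(J)` of the averaged system. -/
def averagedField (_τ : ℝ) (J : Vec) : Vec := avg f J

/-- `J(τ) = (P₀, E₀, Y₀ - 3πτ/P₀²)`. -/
def J (P₀ E₀ Y₀ τ : ℝ) : Vec := ![P₀, E₀, Y₀ - 3 * Real.pi / P₀ ^ 2 * τ]

/-- `dR/dτ = (∂f̄/∂I)(J) R`, `R(0) = 1` on `[0, U)`. -/
def IsR (P₀ E₀ Y₀ U : ℝ) (R : ℝ → Mat) : Prop :=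
  R 0 = 1 ∧ ∀ τ ∈ Set.Ico 0 U, ∀ i j,
    HasDerivWithinAt (fun σ => R σ i j) ((jac (avg f) (J P₀ E₀ Y₀ τ) * R τ) i j) (Set.Ico 0 U) τ

/-- `dK/dτ = (∂f̄/∂I)(J) K + p̄(J)`, `K(0) = 0` on `[0, U)`. -/
def IsK (P₀ E₀ Y₀ U : ℝ) (K : ℝ → Vec) : Prop :=
  K 0 = 0 ∧ ∀ τ ∈ Set.Ico 0 U,
    HasDerivWithinAt K
      ((jac (avg f) (J P₀ E₀ Y₀ τ)).mulVec (K τ) + avg (pAux f) (J P₀ E₀ Y₀ τ))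
      (Set.Ico 0 U) τ

/-! ### The explicit majorants

Throughout, `Pm = P₀ - r^P`, `Pp = P₀ + r^P`, `Em = E₀ - r^E`, `Ep = E₀ + r^E`. -/

/-- The matrix `aⁱⱼ(r)`. -/
def aMaj (P₀ E₀ : ℝ) (r : Vec) : Mat :=
  let Pm := P₀ - r 0
  let Em := E₀ - r 1
  let Ep := E₀ + r 1
  !![(3 + 4 * Ep) / Pm ^ 2,
      4 / Pm,
      4 * Ep / Pm;
     (32 + 45 * Ep + 32 * Ep ^ 2) / (4 * Pm ^ 3),
      (45 + 64 * Ep) / (8 * Pm ^ 2),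
      (16 + 15 * Ep + 20 * Ep ^ 2) / (4 * Pm ^ 2);
     (32 + 33 * Ep + 29 * Ep ^ 2) / (4 * Pm ^ 3 * Em),
      (32 + 29 * Ep ^ 2) / (8 * Pm ^ 2 * Em ^ 2),
      (32 + 30 * Ep + 37 * Ep ^ 2) / (8 * Pm ^ 2 * Em)]

/-- The vector `bⁱ(r)`. -/
def bMaj (P₀ E₀ : ℝ) (r : Vec) : Vec :=
  let Pm := P₀ - r 0
  let Pp := P₀ + r 0
  let Em := E₀ - r 1
  let Ep := E₀ + r 1
  ![(54 + 112 * Ep + 33 * Ep ^ 2) / (8 * Pm ^ 3),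
    (6112 + 10832 * Ep + 6940 * Ep ^ 2 + 11372 * Ep ^ 3 + 1441 * Ep ^ 4)
      / (512 * Pm ^ 4 * Em),
    (3520 * P₀ ^ 3 + 16384 * P₀ ^ 3 * Ep + 9340 * P₀ ^ 3 * Ep ^ 2 + 8940 * P₀ ^ 3 * Ep ^ 3
        + 1861 * P₀ ^ 3 * Ep ^ 4 + 1152 * Ep ^ 2 * Pp ^ 3 + 4608 * Ep ^ 3 * Pp ^ 3)
      / (256 * P₀ ^ 3 * Em ^ 2 * Pm ^ 4)]

/-- The vector `cⁱ(r)`. -/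
def cMaj (P₀ E₀ : ℝ) (r : Vec) : Vec :=
  let Pm := P₀ - r 0
  let Pp := P₀ + r 0
  let Em := E₀ - r 1
  let Ep := E₀ + r 1
  ![3 * Real.pi * (504 + 1024 * Ep + 713 * Ep ^ 2 + 124 * Ep ^ 3) / (8 * Pm ^ 5),
    3 * Real.pi / (2048 * Pm ^ 6 * Em ^ 2) *
      (148736 + 738384 * Ep + 1062656 * Ep ^ 2 + 1220344 * Ep ^ 3 + 675146 * Ep ^ 4
        + 336591 * Ep ^ 5 + 26855 * Ep ^ 6),
    Real.pi / (1024 * P₀ ^ 3 * Em ^ 3 * Pm ^ 6) *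
      (370944 * P₀ ^ 3 + 2214336 * P₀ ^ 3 * Ep + 5434752 * P₀ ^ 3 * Ep ^ 2
        + 4927104 * P₀ ^ 3 * Ep ^ 3 + 2945040 * P₀ ^ 3 * Ep ^ 4 + 1225668 * P₀ ^ 3 * Ep ^ 5
        + 147777 * P₀ ^ 3 * Ep ^ 6 + 231936 * Ep ^ 3 * Pp ^ 3 + 442368 * Ep ^ 4 * Pp ^ 3
        + 196608 * Ep ^ 5 * Pp ^ 3)]

/-- The matrix `dⁱⱼ(r)`. -/
def dMaj (P₀ E₀ : ℝ) (r : Vec) : Mat :=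
  let Pm := P₀ - r 0
  let Ep := E₀ + r 1
  !![9 * Real.pi * Ep ^ 2 / (2 * Pm ^ 4),
      3 * Real.pi * Ep / Pm ^ 3,
      3 * Real.pi * Ep ^ 2 / Pm ^ 3;
     3 * Real.pi * Ep * (10 + Ep ^ 2) / Pm ^ 5,
      3 * Real.pi * (10 + 3 * Ep ^ 2) / (4 * Pm ^ 4),
      3 * Real.pi * Ep * (10 + Ep ^ 2) / (2 * Pm ^ 4);
     3 * Real.pi * (74 + 35 * Ep ^ 2) / (4 * Pm ^ 5),
      105 * Real.pi * Ep / (8 * Pm ^ 4),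
      15 * Real.pi * (4 + Ep ^ 2) / (4 * Pm ^ 4)]

/-- The tensor `eⁱⱼₖ(r)`: the only nonzero component is `e^Y_PP = 18π / (P₀ - r^P)⁴`. -/
def eMaj (P₀ : ℝ) (r : Vec) (i j k : Fin 3) : ℝ :=
  if i = 2 ∧ j = 0 ∧ k = 0 then 18 * Real.pi / (P₀ - r 0) ^ 4 else 0

/-- The matrices `Rⁱⱼ(τ) = Pⁱⱼ(τ)` bounding `|R(τ)|` and `|R⁻¹(τ)|` entrywise. -/
def RMaj (P₀ τ : ℝ) : Mat :=
  !![1, 0, 0; 0, 1, 0; 6 * Real.pi / P₀ ^ 3 * τ, 0, 1]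

/-- `αⁱ(τ, r) = a₍₀₎ⁱ(τ) + aⁱₖ(r) rᵏ + ε bⁱ(r)`. -/
def α (P₀ E₀ ε : ℝ) (a₀ : ℝ → Vec) (τ : ℝ) (r : Vec) : Vec :=
  a₀ τ + (aMaj P₀ E₀ r).mulVec r + ε • bMaj P₀ E₀ r

/-- `γⁱ(r, ℓ) = cⁱ(r) + dⁱⱼ(r) ℓʲ + ½ eⁱⱼₖ(r) ℓʲ ℓᵏ`. -/
def γ (P₀ E₀ : ℝ) (r ℓ : Vec) : Vec := fun i =>
  cMaj P₀ E₀ r i + (∑ j, dMaj P₀ E₀ r i j * ℓ j)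
    + 1 / 2 * ∑ j, ∑ k, eMaj P₀ r i j k * ℓ j * ℓ k

/-- The matrix `1 - ε ∂α/∂r (τ, r)`. -/
def oneSubDα (P₀ E₀ ε : ℝ) (a₀ : ℝ → Vec) (τ : ℝ) (r : Vec) : Mat :=
  1 - ε • jac (α P₀ E₀ ε a₀ τ) r

/-- The Cauchy problem on `[0, U)` for the estimators `(m, n)`, with initial datum `(0, ℓ₀)`. -/
structure SolvesEstimatorSystem (P₀ E₀ ε U : ℝ) (a₀ : ℝ → Vec) (ℓ₀ : Vec)
    (m n : ℝ → Vec) : Prop where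
  m_zero : m 0 = 0
  n_zero : n 0 = ℓ₀
  m_deriv : ∀ τ ∈ Set.Ico 0 U,
    HasDerivWithinAt m ((RMaj P₀ τ).mulVec (γ P₀ E₀ (ε • n τ) (n τ))) (Set.Ico 0 U) τ
  n_deriv : ∀ τ ∈ Set.Ico 0 U,
    HasDerivWithinAt n
      ((oneSubDα P₀ E₀ ε a₀ τ (ε • n τ))⁻¹.mulVec
        (derivWithin (fun σ => α P₀ E₀ ε a₀ σ (ε • n τ)) (Set.Ico 0 U) τ
          + ε • (RMaj P₀ τ * RMaj P₀ τ).mulVec (γ P₀ E₀ (ε • n τ) (n τ))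
          + ε • (Matrix.of fun i j => deriv (fun σ => RMaj P₀ σ i j) τ).mulVec (m τ)))
      (Set.Ico 0 U) τ

/-- The domain conditions on `n`. -/
def MeetsDomainConditions (P₀ E₀ ε U : ℝ) (a₀ : ℝ → Vec) (n : ℝ → Vec) : Prop :=
  ∀ τ ∈ Set.Ico 0 U,
    (0 < ε * n τ 0 ∧ ε * n τ 0 < P₀) ∧
    (0 < ε * n τ 1 ∧ ε * n τ 1 < min E₀ (1 - E₀)) ∧
    0 < n τ 2 ∧
    0 < (oneSubDα P₀ E₀ ε a₀ τ (ε • n τ)).det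

end PolarJ2

end

open PolarJ2

/-!
Averaging for the polar `J₂` problem: why the error is controlled by the estimators `m, n`.

Put `L = (I - J)/ε`. Since `f = f̄ + 2π ∂s/∂ϑ` and `p = p̄ + 2π ∂w/∂ϑ`, the oscillating parts of `L'`
are total derivatives along the solution up to terms of higher order in `ε`. With the constant
matrix `M = ∂f̄/∂I (J)`, whose only nonzero entry is `κ = 6π/P₀³` at `(Y, P)`, and with
`s = 2π ∂v/∂ϑ`, where `v` and `w` vanish at `ϑ = 0`, the `defect`
`D = L - s + K + ε (w - M v) + R s(I₀, 0)` satisfies `D(0) = 0` and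
`D' = ε M D + (f̄(I) - f̄(J) - ε M L) + ε (p̄(J) - p̄(I)) + ε² (u - M (w + q))`,
`u = (∂w/∂I) f`, `q = (∂v/∂I) f` (`EstimatorData.hasDerivWithinAt_defect`).
The majorants are bounds on the tube `|I - J| ≤ ε n`: `a` for `∂s/∂I`, `b` for `w - M v`, `c` for
`u - M (w + q)`, `d` for `∂p̄/∂I`, `e` for the second derivatives of `f̄`. Hence, as long as the
solution stays in the tube, `|D'|` is smaller than the derivative of `ε R m`, and
`|D| < ε R m` (`EstimatorData.abs_defect_lt`). The differential equation for `n` is the derivative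
of `n = α(τ, ε n) + ε R m` (`n_eq_α_add`), so that `|L| ≤ α(τ, ε n) + |D| < n`
(`EstimatorData.abs_sub_lt`). The bound being strict, there is no first time at which the solution
reaches the boundary of the tube. This yields the estimate, and global existence, as the tube over
a compact interval is a compact part of `Λ` up to the periodic variable `Y`, on which `f` is bounded
and Lipschitz.

The bounds `a, b, c, d` hold because `f, s, p, v, w, u, q` are trigonometric polynomials in `(ϑ, Y)`
whose coefficients are Laurent polynomials in `P, E`: each majorant is the sum of the absolute
values of the coefficients after collecting equal terms. The collected sums are large, `u^E` and
`u^Y` having more than two hundred monomials each, and are therefore treated by reflection.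
`TrigPoly` is a type of formal sums with integer coefficients; differentiation, multiplication,
integration in `ϑ` and collection are computable functions on it, proved correct with respect to
the evaluation `ev`. The kernel computes the coefficient sums (`maj_lie_W1` and its companions), and
`abs_ev_le_polyVal` turns them into estimates.
-/

namespace PolarJ2

/-! ### Trigonometric polynomials with Laurent monomial coefficients -/

/-- `sin` or `cos`, according to the Boolean. -/
noncomputable def trig (s : Bool) (x : ℝ) : ℝ := bif s then Real.sin x else Real.cos x

/-- The monomial `c P^p E^e trig(k ϑ + l Y)`, where `trig` is `sin` if `s` is true and `cos`
otherwise. -/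
structure Mono where
  c : ℤ
  p : ℤ
  e : ℤ
  k : ℤ
  l : ℤ
  s : Bool

/-- The value of a monomial. -/
noncomputable def Mono.val (m : Mono) (I : Vec) (θ : ℝ) : ℝ :=
  m.c * I 0 ^ m.p * I 1 ^ m.e * trig m.s (m.k * θ + m.l * I 2)

/-- Formal sums of monomials, neither sorted nor collected. All operations below are computable on
such lists, so that the kernel can evaluate them. -/
abbrev TrigPoly : Type := List Mono

/-- The function of `(I, ϑ)` represented by a formal sum. -/
noncomputable def ev (A : TrigPoly) (I : Vec) (θ : ℝ) : ℝ := (A.map fun m => m.val I θ).sum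

/-- Formal multiplication by an integer. -/
def scale (n : ℤ) (A : TrigPoly) : TrigPoly := A.map fun m => { m with c := n * m.c }

/-- Formal `∂/∂P`. -/
def dP (A : TrigPoly) : TrigPoly := A.map fun m => { m with c := m.c * m.p, p := m.p - 1 }

/-- Formal `∂/∂E`. -/
def dE (A : TrigPoly) : TrigPoly := A.map fun m => { m with c := m.c * m.e, e := m.e - 1 }

/-- Formal `∂/∂Y`. -/
def dY (A : TrigPoly) : TrigPoly :=
  A.map fun m => { m with c := m.c * m.l * (bif m.s then 1 else -1), s := !m.s }

/-- Formal `∂/∂ϑ`. -/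
def dθ (A : TrigPoly) : TrigPoly :=
  A.map fun m => { m with c := m.c * m.k * (bif m.s then 1 else -1), s := !m.s }

/-- The partial derivatives with respect to `P, E, Y`. -/
def dI (j : Fin 3) (A : TrigPoly) : TrigPoly := ![dP A, dE A, dY A] j

/-- Twice the product of two monomials, by the product-to-sum formulas; the factor two keeps the
coefficients integral. -/
def Mono.mul (m m' : Mono) : TrigPoly :=
  [{ c := m.c * m'.c * (bif m.s && m'.s then -1 else 1), p := m.p + m'.p, e := m.e + m'.e,
     k := m.k + m'.k, l := m.l + m'.l, s := xor m.s m'.s },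
   { c := m.c * m'.c * (bif !m.s && m'.s then -1 else 1), p := m.p + m'.p, e := m.e + m'.e,
     k := m.k - m'.k, l := m.l - m'.l, s := xor m.s m'.s }]

/-- Twice the formal product. -/
def mul (A B : TrigPoly) : TrigPoly := A.flatMap fun m => B.flatMap fun m' => m.mul m'

/-- The part independent of `ϑ`. -/
def meanPart (A : TrigPoly) : TrigPoly := A.filter fun m => m.k == 0

/-- The oscillating part. -/
def oscPart (A : TrigPoly) : TrigPoly := A.filter fun m => !(m.k == 0)

/-- `n` times a primitive in `ϑ`, for sums whose angular frequencies divide `n`. -/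
def prim (n : ℤ) (A : TrigPoly) : TrigPoly :=
  A.map fun m => { m with c := m.c * (n / m.k) * (bif m.s then -1 else 1), s := !m.s }

/-- The restriction to `ϑ = 0`. -/
def atZero (A : TrigPoly) : TrigPoly := A.map fun m => { m with k := 0 }

/-- All angular frequencies are nonzero divisors of `n`. -/
def freqDvd (n : ℤ) (A : TrigPoly) : Bool := A.all fun m => !(m.k == 0) && n % m.k == 0

/-! ### Collecting terms -/

/-- Uses `cos (-x) = cos x`, `sin (-x) = -sin x` to make the leading frequency nonnegative, and
`sin 0 = 0` to discard the sine of frequency zero. -/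
def Mono.canon (m : Mono) : Mono :=
  bif decide (m.k < 0) || (m.k == 0 && decide (m.l < 0)) then
    { m with c := bif m.s then -m.c else m.c, k := -m.k, l := -m.l }
  else bif m.s && (m.k == 0 && m.l == 0) then { m with c := 0 }
  else m

/-- A sorting key. Only the quality of the collection depends on it, not its correctness. -/
def Mono.code (m : Mono) : ℕ := (m.k.toNat * 64 + (m.l + 32).toNat) * 64 + (m.e + 32).toNat

/-- The two monomials differ by the coefficient only. -/
def Mono.same (m m' : Mono) : Bool :=
  m.p == m'.p && m.e == m'.e && m.k == m'.k && m.l == m'.l && m.s == m'.s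

/-- Moves the entries of `B` sorted before `m` to the front, then `m`, then continues with `g` on
the rest. Splitting `merge` this way makes both recursions structural, hence fast in the kernel. -/
def mergeAux (m : Mono) (g : TrigPoly → TrigPoly) : TrigPoly → TrigPoly
  | [] => m :: g []
  | b :: B =>
    bif Nat.blt m.code b.code then m :: g (b :: B)
    else bif m.same b then { m with c := m.c + b.c } :: g B
    else b :: mergeAux m g B

/-- Merges two sorted sums, adding the coefficients of equal terms. -/
def merge : TrigPoly → TrigPoly → TrigPoly
  | [] => fun B => B
  | m :: A => mergeAux m (merge A)

/-- Splits a list into its entries of even and of odd position. -/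
def halves : TrigPoly → TrigPoly × TrigPoly
  | [] => ([], [])
  | m :: A => (m :: (halves A).2, (halves A).1)

/-- Merge sort with at most `n` levels. -/
def collectAux : ℕ → TrigPoly → TrigPoly
  | 0, A => A
  | _ + 1, [] => []
  | _ + 1, [m] => [m]
  | n + 1, m :: m' :: A =>
    merge (collectAux n (m :: (halves A).1)) (collectAux n (m' :: (halves A).2))

/-- Collects equal terms. Lists of up to `2 ^ 14` entries, more than any list below has, are
collected completely. -/
def collect (A : TrigPoly) : TrigPoly := collectAux 14 (A.map Mono.canon)

/-! ### Coefficient weights -/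

/-- The sum of the absolute values of the coefficients at the power `E^(j-d)`. -/
def weight (A : TrigPoly) (d : ℤ) (j : ℕ) : ℕ :=
  (A.map fun m => bif m.e + d == (j : ℤ) then m.c.natAbs else 0).sum

/-- All nonzero terms carry the power `P^(-p)` and a power `E^(j-d)` with `j < n`. -/
def fits (A : TrigPoly) (p d : ℤ) (n : ℕ) : Bool :=
  A.all fun m => m.c == 0 || (m.p == -p && decide (0 ≤ m.e + d) && decide (m.e + d < (n : ℤ)))

/-- All terms of `A` carry `P^(-p)` and some `E^(j-d)`, and the weights for `j = 0, 1, …` are the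
entries of `L`. -/
def majOK (A : TrigPoly) (p d : ℤ) (L : List ℕ) : Bool :=
  fits A p d L.length && (List.range L.length).map (weight A d) == L

/-! ### The Fourier data of the polar `J₂` problem -/

/-- `f = (π/8) F`. -/
def F : Fin 3 → TrigPoly := ![
  [⟨48, -1, 1, 1, 1, true⟩, ⟨96, -1, 0, 2, 0, true⟩, ⟨48, -1, 1, 3, -1, true⟩],
  [⟨3, -2, 2, 1, -3, true⟩, ⟨24, -2, 0, 1, -1, true⟩, ⟨6, -2, 2, 1, -1, true⟩,
   ⟨12, -2, 0, 1, 1, true⟩, ⟨33, -2, 2, 1, 1, true⟩, ⟨24, -2, 1, 2, -2, true⟩,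
   ⟨120, -2, 1, 2, 0, true⟩, ⟨6, -2, 2, 3, -3, true⟩, ⟨84, -2, 0, 3, -1, true⟩,
   ⟨51, -2, 2, 3, -1, true⟩, ⟨72, -2, 1, 4, -2, true⟩, ⟨15, -2, 2, 5, -3, true⟩],
  [⟨-24, -2, 0, 0, 0, false⟩,
   ⟨-3, -2, 1, 1, -3, false⟩, ⟨-24, -2, -1, 1, -1, false⟩, ⟨-18, -2, 1, 1, -1, false⟩,
   ⟨12, -2, -1, 1, 1, false⟩, ⟨-21, -2, 1, 1, 1, false⟩, ⟨-24, -2, 0, 2, -2, false⟩,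
   ⟨-72, -2, 0, 2, 0, false⟩, ⟨-6, -2, 1, 3, -3, false⟩, ⟨-84, -2, -1, 3, -1, false⟩,
   ⟨-33, -2, 1, 3, -1, false⟩, ⟨-72, -2, 0, 4, -2, false⟩, ⟨-15, -2, 1, 5, -3, false⟩]]

/-- Twice the formal derivative along `F`. -/
def lie (A : TrigPoly) : TrigPoly :=
  collect (mul (dP A) (F 0) ++ (mul (dE A) (F 1) ++ mul (dY A) (F 2)))

/-- `s = S / 960`: the primitive of `f - f̄` with mean zero. -/
def S (i : Fin 3) : TrigPoly := prim 60 (oscPart (F i))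

/-- `p = (∂s/∂I) f = (π/15360) Pl`. -/
def Pl (i : Fin 3) : TrigPoly := lie (S i)

/-- The primitive of `p - p̄` with mean zero, up to a factor. -/
def Wosc (i : Fin 3) : TrigPoly := prim 2520 (oscPart (Pl i))

/-- `w = W / 77414400`: the solution of `p = p̄ + 2π ∂w/∂ϑ` which vanishes at `ϑ = 0`. -/
def W (i : Fin 3) : TrigPoly := collect (Wosc i ++ scale (-1) (atZero (Wosc i)))

/-- The primitive of `s^P` with mean zero, up to a factor. -/
def Vosc : TrigPoly := prim 60 (S 0)

/-- `v^P = V / (2π · 57600)`: the `P` component of the solution of `s = 2π ∂v/∂ϑ` which vanishes at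
`ϑ = 0`. Only this component enters, since `∂f̄/∂I` has the single nonzero entry `(Y, P)`. -/
def V : TrigPoly := collect (Vosc ++ scale (-1) (atZero Vosc))

/-! ### Correctness of the formal operations -/

@[simp] lemma ev_nil (I : Vec) (θ : ℝ) : ev [] I θ = 0 := rfl

@[simp] lemma ev_cons (m : Mono) (A : TrigPoly) (I : Vec) (θ : ℝ) :
    ev (m :: A) I θ = m.val I θ + ev A I θ := by simp [ev]

@[simp] lemma ev_append (A B : TrigPoly) (I : Vec) (θ : ℝ) :
    ev (A ++ B) I θ = ev A I θ + ev B I θ := by simp [ev]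

lemma ev_scale (n : ℤ) (A : TrigPoly) (I : Vec) (θ : ℝ) :
    ev (scale n A) I θ = n * ev A I θ := by
  induction A with
  | nil => simp [scale]
  | cons m A ih =>
    have : ev (scale n (m :: A)) I θ = Mono.val { m with c := n * m.c } I θ + ev (scale n A) I θ :=
      ev_cons _ _ _ _
    rw [this, ih, ev_cons]
    simp only [Mono.val]
    push_cast
    ring

lemma trig_neg (s : Bool) (x : ℝ) : trig s (-x) = (bif s then -1 else 1) * trig s x := by
  cases s <;> simp [trig]

lemma Mono.val_canon (m : Mono) (I : Vec) (θ : ℝ) : m.canon.val I θ = m.val I θ := by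
  unfold Mono.canon
  cases h : decide (m.k < 0) || (m.k == 0 && decide (m.l < 0))
  · cases h' : m.s && (m.k == 0 && m.l == 0)
    · rfl
    · simp only [Bool.and_eq_true, beq_iff_eq] at h'
      simp [Mono.val, h'.1, h'.2.1, h'.2.2, trig]
  · have : ((-m.k : ℤ) : ℝ) * θ + ((-m.l : ℤ) : ℝ) * I 2 = -(m.k * θ + m.l * I 2) := by
      push_cast; ring
    simp only [Mono.val, cond_true, this, trig_neg]
    cases m.s <;> simp

lemma ev_map_canon (A : TrigPoly) (I : Vec) (θ : ℝ) : ev (A.map Mono.canon) I θ = ev A I θ := by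
  induction A with
  | nil => rfl
  | cons m A ih => simp [ih, Mono.val_canon]

lemma Mono.val_add_of_same {m m' : Mono} (h : m.same m' = true) (I : Vec) (θ : ℝ) :
    Mono.val { m with c := m.c + m'.c } I θ = m.val I θ + m'.val I θ := by
  simp only [Mono.same, Bool.and_eq_true, beq_iff_eq] at h
  obtain ⟨⟨⟨⟨h1, h2⟩, h3⟩, h4⟩, h5⟩ := h
  simp only [Mono.val, h1, h2, h3, h4, h5]
  push_cast
  ring

lemma ev_mergeAux (m : Mono) (g : TrigPoly → TrigPoly) (a : ℝ) (I : Vec) (θ : ℝ)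
    (hg : ∀ B, ev (g B) I θ = a + ev B I θ) (B : TrigPoly) :
    ev (mergeAux m g B) I θ = m.val I θ + a + ev B I θ := by
  induction B with
  | nil => simp [mergeAux, hg]
  | cons b B ih =>
    unfold mergeAux
    cases Nat.blt m.code b.code
    · cases h : m.same b
      · simp [ih]; ring
      · simp [hg, Mono.val_add_of_same h]; ring
    · simp [hg]; ring

lemma ev_merge (A B : TrigPoly) (I : Vec) (θ : ℝ) :
    ev (merge A B) I θ = ev A I θ + ev B I θ := by
  induction A generalizing B with
  | nil => simp [merge]
  | cons m A ih => simp [merge, ev_mergeAux m (merge A) (ev A I θ) I θ ih]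

lemma ev_halves (A : TrigPoly) (I : Vec) (θ : ℝ) :
    ev (halves A).1 I θ + ev (halves A).2 I θ = ev A I θ := by
  induction A with
  | nil => simp [halves]
  | cons m A ih => simp [halves, ← ih]; ring

lemma ev_collectAux (n : ℕ) (A : TrigPoly) (I : Vec) (θ : ℝ) :
    ev (collectAux n A) I θ = ev A I θ := by
  induction n generalizing A with
  | zero => rfl
  | succ n ih =>
    match A with
    | [] => rfl
    | [m] => rfl
    | m :: m' :: A => simp [collectAux, ev_merge, ih, ← ev_halves A]; ring

lemma ev_collect (A : TrigPoly) (I : Vec) (θ : ℝ) : ev (collect A) I θ = ev A I θ := by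
  simp [collect, ev_collectAux, ev_map_canon]

lemma Mono.ev_mul (m m' : Mono) {I : Vec} (hP : I 0 ≠ 0) (hE : I 1 ≠ 0) (θ : ℝ) :
    ev (m.mul m') I θ = 2 * m.val I θ * m'.val I θ := by
  have h1 : ((m.k + m'.k : ℤ) : ℝ) * θ + ((m.l + m'.l : ℤ) : ℝ) * I 2
      = (m.k * θ + m.l * I 2) + (m'.k * θ + m'.l * I 2) := by push_cast; ring
  have h2 : ((m.k - m'.k : ℤ) : ℝ) * θ + ((m.l - m'.l : ℤ) : ℝ) * I 2
      = (m.k * θ + m.l * I 2) - (m'.k * θ + m'.l * I 2) := by push_cast; ring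
  simp only [Mono.mul, ev_cons, ev_nil, Mono.val, h1, h2, zpow_add₀ hP, zpow_add₀ hE]
  cases m.s <;> cases m'.s <;>
    simp [trig, Real.sin_add, Real.cos_add, Real.sin_sub, Real.cos_sub] <;> ring

lemma ev_mul (A B : TrigPoly) {I : Vec} (hP : I 0 ≠ 0) (hE : I 1 ≠ 0) (θ : ℝ) :
    ev (mul A B) I θ = 2 * ev A I θ * ev B I θ := by
  have aux (m : Mono) (B : TrigPoly) :
      ev (B.flatMap fun m' => m.mul m') I θ = 2 * m.val I θ * ev B I θ := by
    induction B with
    | nil => simp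
    | cons b B ih => simp [ih, Mono.ev_mul m b hP hE]; ring
  induction A with
  | nil => simp [mul]
  | cons m A ih =>
    have : ev (mul (m :: A) B) I θ
        = ev (B.flatMap fun m' => m.mul m') I θ + ev (mul A B) I θ := by
      simp [mul]
    rw [this, ih, aux, ev_cons]
    ring

lemma ev_lie (A : TrigPoly) {I : Vec} (hP : I 0 ≠ 0) (hE : I 1 ≠ 0) (θ : ℝ) :
    ev (lie A) I θ = 2 * ∑ j, ev (dI j A) I θ * ev (F j) I θ := by
  simp [lie, ev_collect, ev_mul _ _ hP hE, dI, Fin.sum_univ_three]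
  ring

lemma ev_meanPart_add_oscPart (A : TrigPoly) (I : Vec) (θ : ℝ) :
    ev (meanPart A) I θ + ev (oscPart A) I θ = ev A I θ := by
  induction A with
  | nil => simp [meanPart, oscPart]
  | cons m A ih =>
    rw [ev_cons, ← ih]
    cases h : m.k == 0
    · simp [meanPart, oscPart, h]; ring
    · simp [meanPart, oscPart, h]; ring

lemma ev_meanPart (A : TrigPoly) (I : Vec) (θ θ' : ℝ) :
    ev (meanPart A) I θ = ev (meanPart A) I θ' := by
  induction A with
  | nil => rfl
  | cons m A ih =>
    cases h : m.k == 0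
    · simpa [meanPart, List.filter_cons, h] using ih
    · have h0 : m.k = 0 := by simpa using h
      have : m.val I θ = m.val I θ' := by simp [Mono.val, h0]
      simp only [meanPart, List.filter_cons, h, if_true, ev_cons] at ih ⊢
      rw [this, ih]

lemma ev_atZero (A : TrigPoly) (I : Vec) (θ : ℝ) : ev (atZero A) I θ = ev A I 0 := by
  induction A with
  | nil => rfl
  | cons m A ih =>
    have : ev (atZero (m :: A)) I θ = Mono.val { m with k := 0 } I θ + ev (atZero A) I θ :=
      ev_cons _ _ _ _
    simp [this, ih, Mono.val]

lemma trig_add_two_pi_mul (s : Bool) (x : ℝ) (n : ℤ) :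
    trig s (x + n * (2 * Real.pi)) = trig s x := by
  cases s <;> simp [trig]

lemma ev_add_two_pi (A : TrigPoly) (I : Vec) (θ : ℝ) :
    ev A I (θ + 2 * Real.pi) = ev A I θ := by
  induction A with
  | nil => rfl
  | cons m A ih =>
    have : m.k * (θ + 2 * Real.pi) + m.l * I 2
        = m.k * θ + m.l * I 2 + m.k * (2 * Real.pi) := by ring
    simp only [ev_cons, ih, Mono.val, this, trig_add_two_pi_mul]

/-! ### Derivatives -/

lemma hasDerivAt_trig (s : Bool) (x : ℝ) :
    HasDerivAt (trig s) ((bif s then 1 else -1) * trig (!s) x) x := by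
  cases s
  · exact (Real.hasDerivAt_cos x : HasDerivAt (trig false) _ x).congr_deriv (by simp [trig])
  · exact (Real.hasDerivAt_sin x : HasDerivAt (trig true) _ x).congr_deriv (by simp [trig])

/-- The chain rule for a trigonometric polynomial along a curve. -/
lemma hasDerivWithinAt_ev (A : TrigPoly) {x : ℝ → Vec} {φ : ℝ → ℝ} {x' : Vec} {φ' : ℝ}
    {s : Set ℝ} {t : ℝ} (hx : HasDerivWithinAt x x' s t) (hφ : HasDerivWithinAt φ φ' s t)
    (hP : x t 0 ≠ 0) (hE : x t 1 ≠ 0) :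
    HasDerivWithinAt (fun σ => ev A (x σ) (φ σ))
      ((∑ j, ev (dI j A) (x t) (φ t) * x' j) + ev (dθ A) (x t) (φ t) * φ') s t := by
  have hx' := hasDerivWithinAt_pi.1 hx
  induction A with
  | nil => simpa [dI, dP, dE, dY, dθ, Fin.sum_univ_three] using hasDerivWithinAt_const t s (0 : ℝ)
  | cons m A ih =>
    have h0 := (hasDerivAt_zpow m.p (x t 0) (Or.inl hP)).comp_hasDerivWithinAt t (hx' 0)
    have h1 := (hasDerivAt_zpow m.e (x t 1) (Or.inl hE)).comp_hasDerivWithinAt t (hx' 1)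
    have h2 := (hasDerivAt_trig m.s (m.k * φ t + m.l * x t 2)).comp_hasDerivWithinAt t
      ((hφ.const_mul (m.k : ℝ)).add ((hx' 2).const_mul (m.l : ℝ)))
    have hm := ((h0.const_mul (m.c : ℝ)).mul h1).mul h2
    have := hm.add ih
    simp only [ev_cons]
    refine this.congr_deriv ?_
    simp only [Fin.sum_univ_three, dI, dP, dE, dY, dθ, List.map_cons, ev_cons,
      Matrix.cons_val_zero, Matrix.cons_val_one, Matrix.cons_val, Mono.val, Function.comp]
    cases m.s <;> push_cast <;> simp <;> ring

lemma differentiableAt_ev (A : TrigPoly) (θ : ℝ) {I : Vec} (hP : I 0 ≠ 0) (hE : I 1 ≠ 0) :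
    DifferentiableAt ℝ (fun I => ev A I θ) I := by
  induction A with
  | nil => simp
  | cons m A ih =>
    have h0 : DifferentiableAt ℝ (fun I : Vec => I 0 ^ m.p) I :=
      (differentiableAt_apply 0 I).zpow (Or.inl hP)
    have h1 : DifferentiableAt ℝ (fun I : Vec => I 1 ^ m.e) I :=
      (differentiableAt_apply 1 I).zpow (Or.inl hE)
    have h2 : DifferentiableAt ℝ (fun I : Vec => trig m.s (m.k * θ + m.l * I 2)) I :=
      (hasDerivAt_trig m.s _).differentiableAt.comp I
        (((differentiableAt_apply 2 I).const_mul (m.l : ℝ)).const_add (m.k * θ))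
    have := (((h0.const_mul (m.c : ℝ)).mul h1).mul h2).add ih
    exact this

lemma fderiv_ev (A : TrigPoly) (θ : ℝ) {I : Vec} (hP : I 0 ≠ 0) (hE : I 1 ≠ 0) (v : Vec) :
    fderiv ℝ (fun I => ev A I θ) I v = ∑ j, ev (dI j A) I θ * v j := by
  have hline : HasDerivAt (fun r : ℝ => I + r • v) v 0 := by
    simpa using ((hasDerivAt_id (0 : ℝ)).smul_const v).const_add I
  have hI : I + (0 : ℝ) • v = I := by simp
  have h1 : HasDerivAt (fun r : ℝ => ev A (I + r • v) θ) (fderiv ℝ (fun I => ev A I θ) I v) 0 := by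
    have := (differentiableAt_ev A θ (I := I) hP hE).hasFDerivAt
    rw [← hI] at this
    simpa [Function.comp_def] using this.comp_hasDerivAt (0 : ℝ) hline
  have h2 := (hasDerivWithinAt_ev A (hline.hasDerivWithinAt (s := Set.univ))
    (hasDerivWithinAt_const 0 Set.univ θ) (by simpa using hP) (by simpa using hE)).hasDerivAt
    Filter.univ_mem
  simpa using h1.unique h2

lemma hasDerivAt_ev_angle (A : TrigPoly) {I : Vec} (hP : I 0 ≠ 0) (hE : I 1 ≠ 0) (θ : ℝ) :
    HasDerivAt (fun θ => ev A I θ) (ev (dθ A) I θ) θ := by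
  simpa using (hasDerivWithinAt_ev A (hasDerivWithinAt_const θ Set.univ I)
    (hasDerivWithinAt_id θ Set.univ) hP hE).hasDerivAt Filter.univ_mem

lemma continuous_ev_angle (A : TrigPoly) {I : Vec} (hP : I 0 ≠ 0) (hE : I 1 ≠ 0) :
    Continuous fun θ => ev A I θ :=
  continuous_iff_continuousAt.2 fun θ => (hasDerivAt_ev_angle A hP hE θ).continuousAt

lemma ev_dθ_prim {n : ℤ} {A : TrigPoly} (hA : freqDvd n A = true) (I : Vec) (θ : ℝ) :
    ev (dθ (prim n A)) I θ = n * ev A I θ := by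
  induction A with
  | nil => simp [prim, dθ]
  | cons m A ih =>
    simp only [freqDvd, List.all_cons, Bool.and_eq_true, Bool.not_eq_true', beq_eq_false_iff_ne,
      beq_iff_eq] at hA
    obtain ⟨⟨_, hd⟩, hA⟩ := hA
    have hk : ((n / m.k : ℤ) : ℝ) * m.k = n := by
      exact_mod_cast Int.ediv_mul_cancel (Int.dvd_of_emod_eq_zero hd)
    have ih := ih hA
    simp only [prim, dθ, List.map_cons, ev_cons] at ih ⊢
    rw [ih, mul_add, ← hk]
    simp only [Mono.val]
    cases m.s <;> push_cast <;> simp <;> ring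

lemma ev_dθ_append (A B : TrigPoly) (I : Vec) (θ : ℝ) :
    ev (dθ (A ++ B)) I θ = ev (dθ A) I θ + ev (dθ B) I θ := by simp [dθ]

lemma ev_dθ_scale_atZero (n : ℤ) (A : TrigPoly) (I : Vec) (θ : ℝ) :
    ev (dθ (scale n (atZero A))) I θ = 0 := by
  induction A with
  | nil => rfl
  | cons m A ih =>
    simp only [dθ, scale, atZero, List.map_cons, ev_cons] at ih ⊢
    rw [ih]
    simp [Mono.val]

/-- Collecting terms does not change the derivative in the angle. -/
lemma ev_dθ_collect (A : TrigPoly) {I : Vec} (hP : I 0 ≠ 0) (hE : I 1 ≠ 0) (θ : ℝ) :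
    ev (dθ (collect A)) I θ = ev (dθ A) I θ := by
  have h := hasDerivAt_ev_angle (collect A) hP hE θ
  simp only [ev_collect] at h
  exact h.unique (hasDerivAt_ev_angle A hP hE θ)

lemma integral_ev {n : ℤ} (hn : n ≠ 0) {A : TrigPoly} (hA : freqDvd n A = true) {I : Vec}
    (hP : I 0 ≠ 0) (hE : I 1 ≠ 0) (θ : ℝ) :
    ∫ θ' in (0 : ℝ)..θ, ev A I θ' = (ev (prim n A) I θ - ev (prim n A) I 0) / n := by
  have hn' : (n : ℝ) ≠ 0 := by exact_mod_cast hn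
  have h := intervalIntegral.integral_eq_sub_of_hasDerivAt (a := 0) (b := θ)
    (f := fun θ => ev (prim n A) I θ) (f' := fun θ => n * ev A I θ)
    (fun x _ => by simpa [ev_dθ_prim hA] using hasDerivAt_ev_angle (prim n A) hP hE x)
    ((continuous_const.mul (continuous_ev_angle A hP hE)).intervalIntegrable _ _)
  rw [intervalIntegral.integral_const_mul] at h
  field_simp
  linarith

lemma integral_ev_two_pi {n : ℤ} (hn : n ≠ 0) {A : TrigPoly} (hA : freqDvd n A = true) {I : Vec}
    (hP : I 0 ≠ 0) (hE : I 1 ≠ 0) : ∫ θ' in (0 : ℝ)..2 * Real.pi, ev A I θ' = 0 := by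
  rw [integral_ev hn hA hP hE]
  have := ev_add_two_pi (prim n A) I 0
  rw [zero_add] at this
  simp [this]

/-! ### Bounds on boxes -/

lemma abs_trig_le_one (s : Bool) (x : ℝ) : |trig s x| ≤ 1 := by
  cases s
  · exact Real.abs_cos_le_one x
  · exact Real.abs_sin_le_one x

/-- The termwise bound `|c P^(-p) E^(j-d) trig| ≤ |c| E₊^j / (P₋^p E₋^d)`, summed. -/
lemma abs_ev_le {A : TrigPoly} {p d n : ℕ} (hA : fits A p d n = true) {I : Vec} {Pm Em Ep : ℝ}
    (hPm : 0 < Pm) (hEm : 0 < Em) (hP : Pm ≤ I 0) (hE : Em ≤ I 1) (hE' : I 1 ≤ Ep) (θ : ℝ) :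
    |ev A I θ| ≤ (∑ j ∈ Finset.range n, (weight A d j : ℝ) * Ep ^ j) / (Pm ^ p * Em ^ d) := by
  have hI0 : 0 < I 0 := hPm.trans_le hP
  have hI1 : 0 < I 1 := hEm.trans_le hE
  have hEp : 0 < Ep := hI1.trans_le hE'
  induction A with
  | nil => simp [weight]
  | cons m A ih =>
    simp only [fits, List.all_cons, Bool.and_eq_true] at hA
    obtain ⟨hm, hA⟩ := hA
    have key : |m.val I θ| ≤
        (∑ j ∈ Finset.range n, ((bif m.e + (d : ℤ) == (j : ℤ) then m.c.natAbs else 0 : ℕ) : ℝ)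
          * Ep ^ j) / (Pm ^ p * Em ^ d) := by
      rcases eq_or_ne m.c 0 with h0 | h0
      · simp only [Mono.val, h0]
        simp only [Int.cast_zero, zero_mul, abs_zero]
        positivity
      simp only [Bool.or_eq_true, beq_iff_eq, h0, false_or, Bool.and_eq_true,
        decide_eq_true_eq] at hm
      obtain ⟨⟨hp, hlo⟩, hhi⟩ := hm
      obtain ⟨j, hj⟩ := Int.eq_ofNat_of_zero_le hlo
      have hjn : j < n := by omega
      have hsum : (m.c.natAbs : ℝ) * Ep ^ j ≤ ∑ j ∈ Finset.range n,
          ((bif m.e + (d : ℤ) == (j : ℤ) then m.c.natAbs else 0 : ℕ) : ℝ) * Ep ^ j := by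
        have := Finset.single_le_sum (f := fun j : ℕ =>
          ((bif m.e + (d : ℤ) == (j : ℤ) then m.c.natAbs else 0 : ℕ) : ℝ) * Ep ^ j)
          (fun i _ => by positivity) (Finset.mem_range.2 hjn)
        simpa [hj] using this
      have hval : |m.val I θ| ≤ (m.c.natAbs : ℝ) * I 1 ^ j / (I 0 ^ p * I 1 ^ d) := by
        have he : m.e = (j : ℤ) - (d : ℤ) := by
          have : m.e + (d : ℤ) = j := hj
          omega
        rw [Mono.val, abs_mul, abs_mul, abs_mul, Nat.cast_natAbs, Int.cast_abs, hp, he,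
          zpow_sub₀ hI1.ne', zpow_neg, zpow_natCast, zpow_natCast, zpow_natCast,
          abs_of_pos (inv_pos.2 (pow_pos hI0 p)), abs_of_pos (div_pos (pow_pos hI1 j) (pow_pos hI1 d))]
        refine (mul_le_of_le_one_right (by positivity) (abs_trig_le_one _ _)).trans (le_of_eq ?_)
        field_simp
      refine hval.trans ?_
      gcongr
      exact le_trans (by gcongr) hsum
    have ih := ih hA
    rw [ev_cons]
    refine (abs_add_le _ _).trans ((add_le_add key ih).trans (le_of_eq ?_))
    rw [← add_div, ← Finset.sum_add_distrib]
    congr 1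
    refine Finset.sum_congr rfl fun j _ => ?_
    simp only [weight, List.map_cons, List.sum_cons]
    push_cast
    ring

/-- On a box, uniformly in `Y` and `ϑ`, a trigonometric polynomial is bounded. -/
lemma exists_abs_ev_le (A : TrigPoly) {Pm Pp Em Ep : ℝ} (hPm : 0 < Pm) (hEm : 0 < Em) :
    ∃ C, 0 ≤ C ∧ ∀ I : Vec, ∀ θ : ℝ, Pm ≤ I 0 → I 0 ≤ Pp → Em ≤ I 1 → I 1 ≤ Ep →
      |ev A I θ| ≤ C := by
  have hz {a b x : ℝ} (ha : 0 < a) (h1 : a ≤ x) (h2 : x ≤ b) (z : ℤ) :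
      x ^ z ≤ a ^ z + b ^ z := by
    have hx := ha.trans_le h1
    have hb := hx.trans_le h2
    rcases le_total 0 z with h | h
    · exact (zpow_le_zpow_left₀ h hx.le h2).trans (le_add_of_nonneg_left (by positivity))
    · obtain ⟨k, rfl⟩ : ∃ k : ℕ, z = -(k : ℤ) := ⟨z.natAbs, by omega⟩
      refine le_trans ?_ (le_add_of_nonneg_right (by positivity))
      simp only [zpow_neg, zpow_natCast]
      gcongr
  induction A with
  | nil => exact ⟨0, le_rfl, fun I θ _ _ _ _ => by simp⟩
  | cons m A ih =>
    obtain ⟨C, hC, h⟩ := ih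
    refine ⟨|(m.c : ℝ)| * |Pm ^ m.p + Pp ^ m.p| * |Em ^ m.e + Ep ^ m.e| + C, by positivity,
      fun I θ h1 h2 h3 h4 => ?_⟩
    rw [ev_cons]
    refine (abs_add_le _ _).trans (add_le_add ?_ (h I θ h1 h2 h3 h4))
    have hI0 : 0 < I 0 := hPm.trans_le h1
    have hI1 : 0 < I 1 := hEm.trans_le h3
    rw [Mono.val, abs_mul, abs_mul, abs_mul]
    refine (mul_le_of_le_one_right (by positivity) (abs_trig_le_one _ _)).trans ?_
    gcongr
    · exact hz hPm h1 h2 _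
    · exact hz hEm h3 h4 _

/-- The mean value inequality on a box, with separate bounds for the partial derivatives. -/
lemma abs_ev_sub_le (A : TrigPoly) (θ : ℝ) {Pm Pp Em Ep : ℝ} (hPm : 0 < Pm) (hEm : 0 < Em)
    {C : Vec}
    (hC : ∀ I : Vec, Pm ≤ I 0 → I 0 ≤ Pp → Em ≤ I 1 → I 1 ≤ Ep → ∀ j, |ev (dI j A) I θ| ≤ C j)
    {I I' : Vec} (hI : Pm ≤ I 0 ∧ I 0 ≤ Pp ∧ Em ≤ I 1 ∧ I 1 ≤ Ep)
    (hI' : Pm ≤ I' 0 ∧ I' 0 ≤ Pp ∧ Em ≤ I' 1 ∧ I' 1 ≤ Ep) :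
    |ev A I θ - ev A I' θ| ≤ ∑ j, C j * |I j - I' j| := by
  have hbox (r : ℝ) (hr : r ∈ Set.Icc (0 : ℝ) 1) : Pm ≤ (I' + r • (I - I')) 0 ∧
      (I' + r • (I - I')) 0 ≤ Pp ∧ Em ≤ (I' + r • (I - I')) 1 ∧ (I' + r • (I - I')) 1 ≤ Ep := by
    have hcv (i : Fin 3) (a b : ℝ) (h1 : I i ∈ Set.Icc a b) (h2 : I' i ∈ Set.Icc a b) :
        (I' + r • (I - I')) i ∈ Set.Icc a b := by
      simpa using (convex_Icc a b).add_smul_sub_mem h2 h1 hr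
    have h0 := hcv 0 Pm Pp ⟨hI.1, hI.2.1⟩ ⟨hI'.1, hI'.2.1⟩
    have h1 := hcv 1 Em Ep ⟨hI.2.2.1, hI.2.2.2⟩ ⟨hI'.2.2.1, hI'.2.2.2⟩
    exact ⟨h0.1, h0.2, h1.1, h1.2⟩
  have hd (r : ℝ) (hr : r ∈ Set.Icc (0 : ℝ) 1) :
      HasDerivWithinAt (fun r : ℝ => ev A (I' + r • (I - I')) θ)
        (∑ j, ev (dI j A) (I' + r • (I - I')) θ * (I - I') j) (Set.Icc 0 1) r := by
    have hline : HasDerivAt (fun r : ℝ => I' + r • (I - I')) (I - I') r := by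
      simpa using ((hasDerivAt_id r).smul_const (I - I')).const_add I'
    obtain ⟨h0, -, h1, -⟩ := hbox r hr
    simpa using hasDerivWithinAt_ev A (hline.hasDerivWithinAt (s := Set.Icc 0 1))
      (hasDerivWithinAt_const r (Set.Icc 0 1) θ) (hPm.trans_le h0).ne' (hEm.trans_le h1).ne'
  have := norm_image_sub_le_of_norm_deriv_le_segment_01' hd (C := ∑ j, C j * |I j - I' j|) ?_
  · simpa using this
  · intro r hr
    have hr' := Set.Ico_subset_Icc_self hr
    obtain ⟨h0, h0', h1, h1'⟩ := hbox r hr'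
    refine (norm_sum_le _ _).trans (Finset.sum_le_sum fun j _ => ?_)
    rw [norm_mul, Real.norm_eq_abs, Real.norm_eq_abs, Pi.sub_apply]
    gcongr
    exact hC _ h0 h0' h1 h1' j

/-! ### Evaluation of the weights -/

/-- The value at `x` of the polynomial with the given list of coefficients. -/
noncomputable def polyVal (x : ℝ) : List ℕ → ℝ
  | [] => 0
  | a :: L => a + x * polyVal x L

lemma sum_range_eq_polyVal (g : ℕ → ℕ) (n : ℕ) (x : ℝ) :
    ∑ j ∈ Finset.range n, (g j : ℝ) * x ^ j = polyVal x ((List.range n).map g) := by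
  induction n generalizing g with
  | zero => rfl
  | succ n ih =>
    rw [Finset.sum_range_succ', List.range_succ_eq_map, List.map_cons, polyVal, List.map_map,
      ← ih (g ∘ Nat.succ), Finset.mul_sum, add_comm]
    simp only [pow_zero, mul_one, Function.comp, Nat.succ_eq_add_one]
    congr 1
    exact Finset.sum_congr rfl fun j _ => by ring

lemma abs_ev_le_polyVal {A : TrigPoly} {p d : ℕ} {L : List ℕ} (hA : majOK A p d L = true)
    {I : Vec} {Pm Em Ep : ℝ} (hPm : 0 < Pm) (hEm : 0 < Em) (hP : Pm ≤ I 0) (hE : Em ≤ I 1)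
    (hE' : I 1 ≤ Ep) (θ : ℝ) : |ev A I θ| ≤ polyVal Ep L / (Pm ^ p * Em ^ d) := by
  simp only [majOK, Bool.and_eq_true, beq_iff_eq] at hA
  refine (abs_ev_le hA.1 hPm hEm hP hE hE' θ).trans (le_of_eq ?_)
  rw [sum_range_eq_polyVal, hA.2]

lemma freqDvd_osc_F (i : Fin 3) : freqDvd 60 (oscPart (F i)) = true := by
  fin_cases i <;> decide +kernel

lemma freqDvd_S (i : Fin 3) : freqDvd 60 (S i) = true := by
  fin_cases i <;> decide +kernel

lemma freqDvd_osc_Pl (i : Fin 3) : freqDvd 2520 (oscPart (Pl i)) = true := by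
  fin_cases i <;> decide +kernel

/-- The weights of `∂s/∂I`, multiplied by `960`. -/
lemma maj_dI_S :
    majOK (dI 0 (S 0)) 2 0 [2880, 3840] = true ∧
    majOK (dI 1 (S 0)) 1 0 [3840] = true ∧
    majOK (dI 2 (S 0)) 1 0 [0, 3840] = true ∧
    majOK (dI 0 (S 1)) 3 0 [7680, 10800, 7680] = true ∧
    majOK (dI 1 (S 1)) 2 0 [5400, 7680] = true ∧
    majOK (dI 2 (S 1)) 2 0 [3840, 3600, 4800] = true ∧
    majOK (dI 0 (S 2)) 3 1 [7680, 7920, 6960] = true ∧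
    majOK (dI 1 (S 2)) 2 2 [3840, 0, 3480] = true ∧
    majOK (dI 2 (S 2)) 2 1 [3840, 3600, 4440] = true := by decide +kernel

/-- The weights of `∂p̄^P/∂I`, multiplied by `15360/π`; similarly for `E` and `Y` below. -/
lemma maj_dI_mean_Pl0 :
    majOK (dI 0 (meanPart (Pl 0))) 4 0 [0, 0, 69120] = true ∧
    majOK (dI 1 (meanPart (Pl 0))) 3 0 [0, 46080] = true ∧
    majOK (dI 2 (meanPart (Pl 0))) 3 0 [0, 0, 46080] = true := by decide +kernel

lemma maj_dI_mean_Pl1 :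
    majOK (dI 0 (meanPart (Pl 1))) 5 0 [0, 460800, 0, 46080] = true ∧
    majOK (dI 1 (meanPart (Pl 1))) 4 0 [115200, 0, 34560] = true ∧
    majOK (dI 2 (meanPart (Pl 1))) 4 0 [0, 230400, 0, 23040] = true := by decide +kernel

lemma maj_dI_mean_Pl2 :
    majOK (dI 0 (meanPart (Pl 2))) 5 0 [852480, 0, 403200] = true ∧
    majOK (dI 1 (meanPart (Pl 2))) 4 0 [0, 201600] = true ∧
    majOK (dI 2 (meanPart (Pl 2))) 4 0 [230400, 0, 57600] = true := by decide +kernel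

/-- The weights of `w^P`, multiplied by `77414400`; similarly for `E` and `Y` below. The factors
`9676800 = 77414400 / 8` etc. make the numerators of `bMaj` visible. -/
lemma maj_W0 : majOK (W 0) 3 0 [54 * 9676800, 112 * 9676800, 33 * 9676800] = true := by
  decide +kernel

lemma maj_W1 : majOK (W 1) 4 1 [6112 * 151200, 10832 * 151200, 6940 * 151200, 11372 * 151200,
    1441 * 151200] = true := by decide +kernel

lemma maj_W2 : majOK (W 2) 4 2 [3520 * 302400, 16384 * 302400, 9340 * 302400, 8940 * 302400,
    1861 * 302400] = true := by decide +kernel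

/-- The weights of `v^P`, multiplied by `2π · 57600`. -/
lemma maj_V : majOK V 1 0 [86400, 345600] = true := by decide +kernel

/-- The weights of `u^P = (∂w^P/∂I) f`, multiplied by `16 · 77414400 / π`; similarly for `E` and `Y`
below. The factors make the numerators of `cMaj` visible. -/
lemma maj_lie_W0 : majOK (lie (W 0)) 5 0 [504 * 464486400, 1024 * 464486400, 713 * 464486400,
    124 * 464486400] = true := by decide +kernel

lemma maj_lie_W1 : majOK (lie (W 1)) 6 2 [148736 * 1814400, 738384 * 1814400, 1062656 * 1814400,
    1220344 * 1814400, 675146 * 1814400, 336591 * 1814400, 26855 * 1814400] = true := by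
  decide +kernel

lemma maj_lie_W2 : majOK (lie (W 2)) 6 3 [370944 * 1209600, 2214336 * 1209600,
    5434752 * 1209600, 4927104 * 1209600, 2945040 * 1209600, 1225668 * 1209600,
    147777 * 1209600] = true := by decide +kernel

/-- The weights of `w^P + q^P`, `q^P = (∂v^P/∂I) f`, multiplied by `77414400`: the factor `42` is
`77414400 / (32 · 57600)`. -/
lemma maj_W0_add_lie_V : majOK (collect (W 0 ++ scale 42 (lie V))) 3 0
    [231936 * 12600, 442368 * 12600, 196608 * 12600] = true := by decide +kernel

open Real

/-! ### The auxiliary functions of the polar `J₂` problem -/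

lemma f_apply {I : Vec} (hP : I 0 ≠ 0) (hE : I 1 ≠ 0) (θ : ℝ) (i : Fin 3) :
    f I θ i = π / 8 * ev (F i) I θ := by
  fin_cases i
  · simp [f, fP, F, Mono.val, trig]
    field_simp
    ring_nf
  · simp [f, fE, F, Mono.val, trig]
    field_simp
    ring_nf
  · simp [f, fY, F, Mono.val, trig]
    field_simp
    ring_nf

lemma continuous_f_angle {I : Vec} (hP : I 0 ≠ 0) (hE : I 1 ≠ 0) (i : Fin 3) :
    Continuous fun θ => f I θ i := by
  simp only [f_apply hP hE]
  exact continuous_const.mul (continuous_ev_angle _ hP hE)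

lemma intervalIntegrable_const_mul_ev (c : ℝ) (A : TrigPoly) {I : Vec} (hP : I 0 ≠ 0)
    (hE : I 1 ≠ 0) (a b : ℝ) :
    IntervalIntegrable (fun θ => c * ev A I θ) MeasureTheory.volume a b :=
  Continuous.intervalIntegrable (continuous_const.mul (continuous_ev_angle A hP hE)) a b

lemma avg_const_mul_ev (c : ℝ) {n : ℤ} (hn : n ≠ 0) {A : TrigPoly}
    (hA : freqDvd n (oscPart A) = true) {I : Vec} (hP : I 0 ≠ 0) (hE : I 1 ≠ 0) :
    1 / (2 * π) * ∫ θ in (0 : ℝ)..2 * π, c * ev A I θ = c * ev (meanPart A) I 0 := by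
  have h1 : ∀ θ, c * ev A I θ = c * ev (meanPart A) I 0 + c * ev (oscPart A) I θ := fun θ => by
    rw [← ev_meanPart_add_oscPart A I θ, ev_meanPart A I θ 0]
    ring
  simp only [h1]
  rw [intervalIntegral.integral_add (by simp)
    (intervalIntegrable_const_mul_ev c _ hP hE _ _),
    intervalIntegral.integral_const, intervalIntegral.integral_const_mul,
    integral_ev_two_pi hn hA hP hE]
  have := pi_pos
  simp
  field_simp

lemma avg_f_apply {I : Vec} (hP : I 0 ≠ 0) (hE : I 1 ≠ 0) (i : Fin 3) :
    avg f I i = π / 8 * ev (meanPart (F i)) I 0 := by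
  simp only [avg, f_apply hP hE]
  exact avg_const_mul_ev _ (by norm_num) (freqDvd_osc_F i) hP hE

lemma avg_f {I : Vec} (hP : I 0 ≠ 0) (hE : I 1 ≠ 0) :
    avg f I = ![0, 0, -(3 * π / I 0 ^ 2)] := by
  ext i
  rw [avg_f_apply hP hE]
  fin_cases i
  · simp [F, meanPart]
  · simp [F, meanPart]
  · simp [F, meanPart, Mono.val, trig]
    field_simp
    norm_num

lemma zAux_f_apply {I : Vec} (hP : I 0 ≠ 0) (hE : I 1 ≠ 0) (θ : ℝ) (i : Fin 3) :
    zAux f I θ i = (ev (S i) I θ - ev (S i) I 0) / 960 := by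
  have h (θ : ℝ) : f I θ i - avg f I i = π / 8 * ev (oscPart (F i)) I θ := by
    rw [f_apply hP hE, avg_f_apply hP hE, ← ev_meanPart_add_oscPart (F i) I θ,
      ev_meanPart _ I θ 0]
    ring
  simp only [zAux, h]
  rw [intervalIntegral.integral_const_mul, integral_ev (by norm_num) (freqDvd_osc_F i) hP hE, S]
  have := pi_pos
  field_simp
  push_cast
  ring

lemma sAux_f_apply {I : Vec} (hP : I 0 ≠ 0) (hE : I 1 ≠ 0) (θ : ℝ) (i : Fin 3) :
    sAux f I θ i = ev (S i) I θ / 960 := by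
  have h : avg (zAux f) I i = -ev (S i) I 0 / 960 := by
    have h1 : ∀ θ, zAux f I θ i = 1 / 960 * ev (S i) I θ - ev (S i) I 0 / 960 := fun θ => by
      rw [zAux_f_apply hP hE]
      ring
    simp only [avg, h1]
    rw [intervalIntegral.integral_sub
      (intervalIntegrable_const_mul_ev _ _ hP hE _ _) (by simp),
      intervalIntegral.integral_const_mul, integral_ev_two_pi (by norm_num) (freqDvd_S i) hP hE]
    have := pi_pos
    simp
    field_simp
  rw [sAux, Pi.sub_apply, h, zAux_f_apply hP hE]
  ring

lemma eventually_ne_zero {I : Vec} (hP : I 0 ≠ 0) (hE : I 1 ≠ 0) :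
    ∀ᶠ I' : Vec in nhds I, I' 0 ≠ 0 ∧ I' 1 ≠ 0 :=
  ((continuous_apply 0).continuousAt.eventually_ne hP).and
    ((continuous_apply 1).continuousAt.eventually_ne hE)

/-- The Jacobian matrix of a vector function given near `I` by trigonometric polynomials. -/
lemma jac_of_eq_ev {g : Vec → Vec} {c : ℝ} {A : Fin 3 → TrigPoly} {θ : ℝ}
    (hg : ∀ I : Vec, I 0 ≠ 0 → I 1 ≠ 0 → ∀ i, g I i = c * ev (A i) I θ) {I : Vec}
    (hP : I 0 ≠ 0) (hE : I 1 ≠ 0) (i j : Fin 3) :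
    jac g I i j = c * ev (dI j (A i)) I θ := by
  have heq : g =ᶠ[nhds I] fun I i => c * ev (A i) I θ := by
    filter_upwards [eventually_ne_zero hP hE] with I' h
    ext i
    exact hg I' h.1 h.2 i
  have hd (i : Fin 3) : DifferentiableAt ℝ (fun I => c * ev (A i) I θ) I :=
    (differentiableAt_ev (A i) θ hP hE).const_mul c
  rw [jac, Matrix.of_apply, heq.fderiv_eq, fderiv_pi hd]
  simp only [ContinuousLinearMap.coe_pi']
  rw [fderiv_const_mul (differentiableAt_ev (A i) θ hP hE), smul_apply,
    fderiv_ev _ _ hP hE, smul_eq_mul]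
  simp [Pi.single_apply]

lemma jac_avg_f {I : Vec} (hP : I 0 ≠ 0) (hE : I 1 ≠ 0) :
    jac (avg f) I = !![0, 0, 0; 0, 0, 0; 6 * π / I 0 ^ 3, 0, 0] := by
  ext i j
  rw [jac_of_eq_ev (fun I hP hE i => avg_f_apply hP hE i) hP hE]
  fin_cases i <;> fin_cases j <;>
    simp [F, meanPart, dI, dP, dE, dY, Mono.val, trig]
  field_simp
  norm_num

lemma pAux_f_apply {I : Vec} (hP : I 0 ≠ 0) (hE : I 1 ≠ 0) (θ : ℝ) (i : Fin 3) :
    pAux f I θ i = π / 15360 * ev (Pl i) I θ := by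
  have h (j : Fin 3) : jac (fun I' => sAux f I' θ) I i j = 1 / 960 * ev (dI j (S i)) I θ :=
    jac_of_eq_ev (fun I hP hE i => by rw [sAux_f_apply hP hE]; ring) hP hE i j
  rw [pAux, Matrix.mulVec, dotProduct, Pl, ev_lie _ hP hE]
  simp only [h, f_apply hP hE, Finset.mul_sum]
  exact Finset.sum_congr rfl fun j _ => by ring

lemma avg_pAux_f_apply {I : Vec} (hP : I 0 ≠ 0) (hE : I 1 ≠ 0) (i : Fin 3) :
    avg (pAux f) I i = π / 15360 * ev (meanPart (Pl i)) I 0 := by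
  simp only [avg, pAux_f_apply hP hE]
  exact avg_const_mul_ev _ (by norm_num) (freqDvd_osc_Pl i) hP hE

lemma ev_dθ_S (i : Fin 3) (I : Vec) (θ : ℝ) :
    ev (dθ (S i)) I θ = 60 * ev (oscPart (F i)) I θ := by
  rw [S, ev_dθ_prim (freqDvd_osc_F i)]
  norm_num

lemma ev_dθ_W (i : Fin 3) {I : Vec} (hP : I 0 ≠ 0) (hE : I 1 ≠ 0) (θ : ℝ) :
    ev (dθ (W i)) I θ = 2520 * ev (oscPart (Pl i)) I θ := by
  rw [W, ev_dθ_collect _ hP hE, ev_dθ_append, ev_dθ_scale_atZero, Wosc,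
    ev_dθ_prim (freqDvd_osc_Pl i)]
  norm_num

lemma ev_dθ_V {I : Vec} (hP : I 0 ≠ 0) (hE : I 1 ≠ 0) (θ : ℝ) :
    ev (dθ V) I θ = 60 * ev (S 0) I θ := by
  rw [V, ev_dθ_collect _ hP hE, ev_dθ_append, ev_dθ_scale_atZero, Vosc, ev_dθ_prim (freqDvd_S 0)]
  norm_num

lemma ev_W_zero (i : Fin 3) (I : Vec) : ev (W i) I 0 = 0 := by
  simp [W, ev_collect, ev_scale, ev_atZero]

lemma ev_V_zero (I : Vec) : ev V I 0 = 0 := by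
  simp [V, ev_collect, ev_scale, ev_atZero]

/-! ### The majorants -/

/-- The Kepler elements within `r` of `(P₀, E₀, ·)` in the first two components. -/
def tube (P₀ E₀ : ℝ) (r : Vec) : Set Vec :=
  {I | P₀ - r 0 ≤ I 0 ∧ I 0 ≤ P₀ + r 0 ∧ E₀ - r 1 ≤ I 1 ∧ I 1 ≤ E₀ + r 1}

section Majorants

variable {P₀ E₀ : ℝ} {r I : Vec}

/-- `|∂sⁱ/∂Iʲ| ≤ aⁱⱼ`. -/
lemma abs_ds_le (hP : 0 < P₀ - r 0) (hE : 0 < E₀ - r 1) (hI : I ∈ tube P₀ E₀ r) (θ : ℝ)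
    (i j : Fin 3) : |ev (dI j (S i)) I θ| ≤ 960 * aMaj P₀ E₀ r i j := by
  obtain ⟨h0, h0', h1, h1'⟩ := hI
  have key {A : TrigPoly} {p d : ℕ} {L : List ℕ} (hA : majOK A p d L = true) :=
    abs_ev_le_polyVal hA hP hE h0 h1 h1' θ
  obtain ⟨m1, m2, m3, m4, m5, m6, m7, m8, m9⟩ := maj_dI_S
  fin_cases i <;> fin_cases j
  · exact (key m1).trans (le_of_eq (by simp [aMaj, polyVal]; field_simp; ring))
  · exact (key m2).trans (le_of_eq (by simp [aMaj, polyVal]; field_simp; ring))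
  · exact (key m3).trans (le_of_eq (by simp [aMaj, polyVal]; field_simp; ring))
  · exact (key m4).trans (le_of_eq (by simp [aMaj, polyVal]; field_simp; ring))
  · exact (key m5).trans (le_of_eq (by simp [aMaj, polyVal]; field_simp; ring))
  · exact (key m6).trans (le_of_eq (by simp [aMaj, polyVal]; field_simp; ring))
  · exact (key m7).trans (le_of_eq (by simp [aMaj, polyVal]; field_simp; ring))
  · exact (key m8).trans (le_of_eq (by simp [aMaj, polyVal]; field_simp; ring))
  · exact (key m9).trans (le_of_eq (by simp [aMaj, polyVal]; field_simp; ring))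

/-- `|∂p̄ⁱ/∂Iʲ| ≤ dⁱⱼ`. -/
lemma abs_dpbar_le (hP : 0 < P₀ - r 0) (hE : 0 < E₀ - r 1) (hI : I ∈ tube P₀ E₀ r) (θ : ℝ)
    (i j : Fin 3) : |ev (dI j (meanPart (Pl i))) I θ| ≤ 15360 / π * dMaj P₀ E₀ r i j := by
  obtain ⟨h0, h0', h1, h1'⟩ := hI
  have key {A : TrigPoly} {p d : ℕ} {L : List ℕ} (hA : majOK A p d L = true) :=
    abs_ev_le_polyVal hA hP hE h0 h1 h1' θ
  have := pi_pos
  obtain ⟨m1, m2, m3⟩ := maj_dI_mean_Pl0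
  obtain ⟨m4, m5, m6⟩ := maj_dI_mean_Pl1
  obtain ⟨m7, m8, m9⟩ := maj_dI_mean_Pl2
  fin_cases i <;> fin_cases j
  · exact (key m1).trans (le_of_eq (by simp [dMaj, polyVal]; field_simp; ring))
  · exact (key m2).trans (le_of_eq (by simp [dMaj, polyVal]; field_simp; ring))
  · exact (key m3).trans (le_of_eq (by simp [dMaj, polyVal]; field_simp; ring))
  · exact (key m4).trans (le_of_eq (by simp [dMaj, polyVal]; field_simp; ring))
  · exact (key m5).trans (le_of_eq (by simp [dMaj, polyVal]; field_simp; ring))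
  · exact (key m6).trans (le_of_eq (by simp [dMaj, polyVal]; field_simp; ring))
  · exact (key m7).trans (le_of_eq (by simp [dMaj, polyVal]; field_simp; ring))
  · exact (key m8).trans (le_of_eq (by simp [dMaj, polyVal]; field_simp; ring))
  · exact (key m9).trans (le_of_eq (by simp [dMaj, polyVal]; field_simp; ring))

/-- The vector `(0, 0, x)`. -/
def onY (x : ℝ) : Vec := ![0, 0, x]

/-- `|w - (∂f̄/∂I)(J) v| ≤ b`. -/
lemma abs_w_le (hP : 0 < P₀ - r 0) (hP' : 0 < P₀) (hE : 0 < E₀ - r 1)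
    (hI : I ∈ tube P₀ E₀ r) (θ : ℝ) (i : Fin 3) :
    |ev (W i) I θ / 77414400 - onY (6 * π / P₀ ^ 3) i * (ev V I θ / (2 * π * 57600))|
      ≤ bMaj P₀ E₀ r i := by
  obtain ⟨h0, h0', h1, h1'⟩ := hI
  have key {A : TrigPoly} {p d : ℕ} {L : List ℕ} (hA : majOK A p d L = true) :=
    abs_ev_le_polyVal hA hP hE h0 h1 h1' θ
  have := pi_pos
  fin_cases i
  · have h := key maj_W0
    simp only [polyVal] at h
    simp only [onY, Fin.zero_eta, Matrix.cons_val_zero, zero_mul, sub_zero, abs_div, bMaj]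
    rw [div_le_iff₀ (by norm_num)]
    refine h.trans (le_of_eq ?_)
    norm_num
    field_simp
    ring
  · have h := key maj_W1
    simp only [polyVal] at h
    simp only [onY, Fin.mk_one, Matrix.cons_val_one, Matrix.cons_val_zero, zero_mul, sub_zero,
      abs_div, bMaj]
    rw [div_le_iff₀ (by norm_num)]
    refine h.trans (le_of_eq ?_)
    norm_num
    field_simp
    ring
  · have h := key maj_W2
    have h' := key maj_V
    have hEp : 0 < E₀ + r 1 := (hE.trans_le h1).trans_le h1'
    have hPp : P₀ - r 0 ≤ P₀ + r 0 := h0.trans h0'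
    have hEE : E₀ - r 1 ≤ E₀ + r 1 := h1.trans h1'
    simp only [polyVal] at h h'
    simp only [onY, bMaj, Fin.reduceFinMk, Matrix.cons_val]
    set Pm := P₀ - r 0
    set Pp := P₀ + r 0
    set Em := E₀ - r 1
    set Ep := E₀ + r 1
    refine (abs_sub _ _).trans ?_
    have e1 : |ev (W 2) I θ / 77414400| ≤
        (3520 + 16384 * Ep + 9340 * Ep ^ 2 + 8940 * Ep ^ 3 + 1861 * Ep ^ 4)
          / (256 * Em ^ 2 * Pm ^ 4) := by
      rw [abs_div, div_le_iff₀ (by norm_num)]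
      refine h.trans (le_of_eq ?_)
      norm_num
      field_simp
      ring
    have e2 : |6 * π / P₀ ^ 3 * (ev V I θ / (2 * π * 57600))| ≤
        (1152 + 4608 * Ep) / (256 * P₀ ^ 3 * Pm) := by
      have : |6 * π / P₀ ^ 3 * (ev V I θ / (2 * π * 57600))| = |ev V I θ| / (19200 * P₀ ^ 3) := by
        rw [abs_mul, abs_div (ev V I θ), abs_of_pos (show 0 < 6 * π / P₀ ^ 3 by positivity),
          abs_of_pos (show 0 < 2 * π * 57600 by positivity)]
        field_simp
        ring
      rw [this, div_le_iff₀ (by positivity)]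
      refine h'.trans (le_of_eq ?_)
      norm_num
      field_simp
      ring
    -- the factor below is at least one; it brings the sum over the common denominator
    have e3 : (1152 + 4608 * Ep) / (256 * P₀ ^ 3 * Pm) ≤
        (1152 + 4608 * Ep) / (256 * P₀ ^ 3 * Pm) * ((Ep ^ 2 * Pp ^ 3) / (Em ^ 2 * Pm ^ 3)) := by
      refine le_mul_of_one_le_right (by positivity) ?_
      rw [one_le_div (by positivity)]
      gcongr
    refine (add_le_add e1 (e2.trans e3)).trans (le_of_eq ?_)
    field_simp
    ring

/-- `|u - (∂f̄/∂I)(J) (w + q)| ≤ c`. -/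
lemma abs_u_le (hP : 0 < P₀ - r 0) (hP' : 0 < P₀) (hE : 0 < E₀ - r 1)
    (hI : I ∈ tube P₀ E₀ r) (θ : ℝ) (i : Fin 3) :
    |π / (16 * 77414400) * ev (lie (W i)) I θ
      - onY (6 * π / P₀ ^ 3) i * ((ev (W 0) I θ + 42 * ev (lie V) I θ) / 77414400)|
      ≤ cMaj P₀ E₀ r i := by
  obtain ⟨h0, h0', h1, h1'⟩ := hI
  have key {A : TrigPoly} {p d : ℕ} {L : List ℕ} (hA : majOK A p d L = true) :=
    abs_ev_le_polyVal hA hP hE h0 h1 h1' θ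
  have hπ := pi_pos
  have hc : |π / (16 * 77414400)| = π / (16 * 77414400) := abs_of_pos (by positivity)
  fin_cases i
  · have h := key maj_lie_W0
    simp only [polyVal] at h
    simp only [onY, Fin.zero_eta, Matrix.cons_val_zero, zero_mul, sub_zero, cMaj]
    rw [abs_mul, hc]
    refine (mul_le_mul_of_nonneg_left h (by positivity)).trans (le_of_eq ?_)
    norm_num
    field_simp
    ring
  · have h := key maj_lie_W1
    simp only [polyVal] at h
    simp only [onY, Fin.mk_one, Matrix.cons_val_one, Matrix.cons_val_zero, zero_mul, sub_zero,
      cMaj]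
    rw [abs_mul, hc]
    refine (mul_le_mul_of_nonneg_left h (by positivity)).trans (le_of_eq ?_)
    norm_num
    field_simp
    ring
  · have h := key maj_lie_W2
    have h' := key maj_W0_add_lie_V
    rw [ev_collect, ev_append, ev_scale] at h'
    have hEp : 0 < E₀ + r 1 := (hE.trans_le h1).trans_le h1'
    have hPp : P₀ - r 0 ≤ P₀ + r 0 := h0.trans h0'
    have hEE : E₀ - r 1 ≤ E₀ + r 1 := h1.trans h1'
    simp only [polyVal, Int.cast_ofNat] at h h'
    simp only [onY, cMaj, Fin.reduceFinMk, Matrix.cons_val]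
    set Pm := P₀ - r 0
    set Pp := P₀ + r 0
    set Em := E₀ - r 1
    set Ep := E₀ + r 1
    refine (abs_sub _ _).trans ?_
    have e1 : |π / (16 * 77414400) * ev (lie (W 2)) I θ| ≤
        π * (370944 + 2214336 * Ep + 5434752 * Ep ^ 2 + 4927104 * Ep ^ 3 + 2945040 * Ep ^ 4
          + 1225668 * Ep ^ 5 + 147777 * Ep ^ 6) / (1024 * Em ^ 3 * Pm ^ 6) := by
      rw [abs_mul, hc]
      refine (mul_le_mul_of_nonneg_left h (by positivity)).trans (le_of_eq ?_)
      norm_num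
      field_simp
      ring
    have e2 : |6 * π / P₀ ^ 3 * ((ev (W 0) I θ + 42 * ev (lie V) I θ) / 77414400)| ≤
        π * (231936 + 442368 * Ep + 196608 * Ep ^ 2) / (1024 * P₀ ^ 3 * Pm ^ 3) := by
      rw [abs_mul, abs_div _ (77414400 : ℝ), abs_of_pos (show 0 < 6 * π / P₀ ^ 3 by positivity),
        abs_of_pos (show (0 : ℝ) < 77414400 by norm_num)]
      refine (mul_le_mul_of_nonneg_left (div_le_div_of_nonneg_right h' (by norm_num))
        (by positivity)).trans (le_of_eq ?_)
      norm_num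
      field_simp
      ring
    -- the factor below is at least one; it brings the sum over the common denominator
    have e3 : π * (231936 + 442368 * Ep + 196608 * Ep ^ 2) / (1024 * P₀ ^ 3 * Pm ^ 3) ≤
        π * (231936 + 442368 * Ep + 196608 * Ep ^ 2) / (1024 * P₀ ^ 3 * Pm ^ 3)
          * ((Ep ^ 3 * Pp ^ 3) / (Em ^ 3 * Pm ^ 3)) := by
      refine le_mul_of_one_le_right (by positivity) ?_
      rw [one_le_div (by positivity)]
      gcongr
    refine (add_le_add e1 (e2.trans e3)).trans (le_of_eq ?_)
    field_simp
    ring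

end Majorants

/-- The second order Taylor remainder of `f̄^Y = -3π/P²`, bounded by `½ e^Y_PP (x - a)²`. -/
lemma abs_favgY_remainder_le {a x m : ℝ} (hm : 0 < m) (ha : m ≤ a) (hx : m ≤ x) :
    |3 * π / a ^ 2 - 3 * π / x ^ 2 - 6 * π / a ^ 3 * (x - a)|
      ≤ 1 / 2 * (18 * π / m ^ 4 * |x - a| * |x - a|) := by
  have hπ := pi_pos
  have ha' := hm.trans_le ha
  have hx' := hm.trans_le hx
  have h : 3 * π / a ^ 2 - 3 * π / x ^ 2 - 6 * π / a ^ 3 * (x - a)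
      = -(3 * π * (2 / (a ^ 3 * x) + 1 / (a ^ 2 * x ^ 2)) * (x - a) ^ 2) := by
    field_simp
    ring
  have h1 : 2 / (a ^ 3 * x) ≤ 2 / (m ^ 3 * m) := by gcongr
  have h2 : 1 / (a ^ 2 * x ^ 2) ≤ 1 / (m ^ 2 * m ^ 2) := by gcongr
  rw [h, abs_neg, abs_of_nonneg (by positivity), mul_assoc _ |x - a|, abs_mul_abs_self, ← pow_two]
  calc _ ≤ 3 * π * (2 / (m ^ 3 * m) + 1 / (m ^ 2 * m ^ 2)) * (x - a) ^ 2 := by gcongr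
    _ = _ := by field_simp; ring

/-! ### The relation between the estimators -/

lemma onY_apply (x : ℝ) (i : Fin 3) : onY x i = x * onY 1 i := by
  fin_cases i <;> simp [onY]

lemma onY_nonneg {x : ℝ} (hx : 0 ≤ x) (i : Fin 3) : 0 ≤ onY x i := by
  fin_cases i <;> simp [onY, hx]

lemma RMaj_mulVec (P₀ τ : ℝ) (v : Vec) (i : Fin 3) :
    (RMaj P₀ τ).mulVec v i = v i + onY (6 * π / P₀ ^ 3) i * τ * v 0 := by
  fin_cases i <;> simp [RMaj, Matrix.mulVec, dotProduct, Fin.sum_univ_three, onY]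
  ring

lemma RMaj_mul_RMaj_mulVec (P₀ τ : ℝ) (v : Vec) (i : Fin 3) :
    (RMaj P₀ τ * RMaj P₀ τ).mulVec v i = v i + 2 * (onY (6 * π / P₀ ^ 3) i * τ * v 0) := by
  rw [← Matrix.mulVec_mulVec, RMaj_mulVec, RMaj_mulVec, RMaj_mulVec]
  simp only [onY, Matrix.cons_val_zero]
  ring

lemma deriv_RMaj_mulVec (P₀ τ : ℝ) (v : Vec) (i : Fin 3) :
    (Matrix.of fun i j => deriv (fun σ => RMaj P₀ σ i j) τ).mulVec v i
      = onY (6 * π / P₀ ^ 3) i * v 0 := by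
  fin_cases i <;> simp [RMaj, Matrix.mulVec, dotProduct, Fin.sum_univ_three, onY]

/-- The part of `α` which does not depend on `τ`. -/
noncomputable def αr (P₀ E₀ ε : ℝ) (r : Vec) : Vec := (aMaj P₀ E₀ r).mulVec r + ε • bMaj P₀ E₀ r

lemma differentiableAt_αr {P₀ E₀ ε : ℝ} (hP : 0 < P₀) {r : Vec} (hPr : 0 < P₀ - r 0)
    (hEr : 0 < E₀ - r 1) :
    DifferentiableAt ℝ (αr P₀ E₀ ε) r := by
  have h1 := hP.ne'
  have h2 := hPr.ne'
  have h3 := hEr.ne'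
  refine differentiableAt_pi.2 fun i => ?_
  fin_cases i <;>
    simp only [αr, aMaj, bMaj, Matrix.mulVec, dotProduct, Fin.sum_univ_three, Pi.add_apply,
      Pi.smul_apply, smul_eq_mul, Matrix.of_apply, Matrix.cons_val, Fin.reduceFinMk,
      Fin.zero_eta, Fin.mk_one] <;>
    fun_prop (disch := positivity)

lemma jac_mulVec {g : Vec → Vec} {r : Vec} (v : Vec) :
    (jac g r).mulVec v = fderiv ℝ g r v := by
  have hv : v = ∑ j, v j • (Pi.single j 1 : Vec) := by
    ext i
    simp [Finset.sum_apply, Pi.single_apply]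
  ext i
  conv_rhs => rw [hv]
  simp [jac, Matrix.mulVec, dotProduct, map_sum, Finset.sum_apply, mul_comm]

/-- A function with vanishing derivative on `[0, U)` is constant. -/
lemma eq_of_hasDerivWithinAt_zero {g : ℝ → ℝ} {U : ℝ}
    (hg : ∀ τ ∈ Set.Ico 0 U, HasDerivWithinAt g 0 (Set.Ico 0 U) τ) {τ : ℝ}
    (hτ : τ ∈ Set.Ico 0 U) : g τ = g 0 := by
  have := (convex_Ico 0 U).norm_image_sub_le_of_norm_hasDerivWithin_le (C := 0) hg (by simp)
    (⟨le_rfl, hτ.1.trans_lt hτ.2⟩ : (0 : ℝ) ∈ Set.Ico 0 U) hτ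
  simpa [sub_eq_zero] using this

section Estimators

variable {P₀ E₀ ε U : ℝ} {a₀ : ℝ → Vec} {ℓ₀ : Vec} {m n : ℝ → Vec}

/-- The estimators satisfy `n = α(τ, εn) + ε R m`: the differential equation for `n` is the
derivative of this relation. -/
lemma n_eq_α_add (hP₀ : 0 < P₀) (ha₀ : ContDiffOn ℝ 2 a₀ (Set.Ico 0 U))
    (hℓ₀ : α P₀ E₀ ε a₀ 0 (ε • ℓ₀) = ℓ₀) (hmn : SolvesEstimatorSystem P₀ E₀ ε U a₀ ℓ₀ m n)
    (hdom : MeetsDomainConditions P₀ E₀ ε U a₀ n) {τ : ℝ} (hτ : τ ∈ Set.Ico 0 U) (i : Fin 3) :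
    n τ i = α P₀ E₀ ε a₀ τ (ε • n τ) i + ε * (RMaj P₀ τ).mulVec (m τ) i := by
  set κ := onY (6 * π / P₀ ^ 3) with hκ
  have hκ0 : κ 0 = 0 := rfl
  have hα (σ : ℝ) (r : Vec) : α P₀ E₀ ε a₀ σ r = a₀ σ + αr P₀ E₀ ε r := by
    simp [α, αr, add_assoc]
  have h (σ : ℝ) (hσ : σ ∈ Set.Ico 0 U) : HasDerivWithinAt
      (fun σ => n σ i - α P₀ E₀ ε a₀ σ (ε • n σ) i - ε * (RMaj P₀ σ).mulVec (m σ) i) 0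
      (Set.Ico 0 U) σ := by
    obtain ⟨⟨-, h1⟩, ⟨-, h2⟩, -, hdet⟩ := hdom σ hσ
    have hn := hmn.n_deriv σ hσ
    have hm := hasDerivWithinAt_pi.1 (hmn.m_deriv σ hσ)
    have hdiff : DifferentiableAt ℝ (αr P₀ E₀ ε) (ε • n σ) :=
      differentiableAt_αr hP₀ (by simpa using h1)
        (by simpa using h2.trans_le (min_le_left _ _))
    have ha : HasDerivWithinAt a₀ (derivWithin a₀ (Set.Ico 0 U) σ) (Set.Ico 0 U) σ :=
      ((ha₀.differentiableOn (by norm_num)) σ hσ).hasDerivWithinAt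
    have hda : derivWithin (fun ς => α P₀ E₀ ε a₀ ς (ε • n σ)) (Set.Ico 0 U) σ
        = derivWithin a₀ (Set.Ico 0 U) σ := by
      simp only [hα]
      exact derivWithin_add_const _
    have hjac : jac (α P₀ E₀ ε a₀ σ) (ε • n σ) = jac (αr P₀ E₀ ε) (ε • n σ) := by
      have : α P₀ E₀ ε a₀ σ = fun r => a₀ σ + αr P₀ E₀ ε r := funext (hα σ)
      simp only [jac, this, fderiv_const_add]
    rw [hda] at hn
    set X := derivWithin a₀ (Set.Ico 0 U) σ
      + ε • (RMaj P₀ σ * RMaj P₀ σ).mulVec (γ P₀ E₀ (ε • n σ) (n σ))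
      + ε • (Matrix.of fun i j => deriv (fun σ => RMaj P₀ σ i j) σ).mulVec (m σ) with hX
    set n' := (oneSubDα P₀ E₀ ε a₀ σ (ε • n σ))⁻¹.mulVec X with hn'
    have hlin : n' - ε • fderiv ℝ (αr P₀ E₀ ε) (ε • n σ) n' = X := by
      have : (oneSubDα P₀ E₀ ε a₀ σ (ε • n σ)).mulVec n' = X := by
        rw [hn', Matrix.mulVec_mulVec, Matrix.mul_nonsing_inv _ (isUnit_iff_ne_zero.2 hdet.ne'),
          Matrix.one_mulVec]
      rw [← this, oneSubDα, Matrix.sub_mulVec, Matrix.one_mulVec, Matrix.smul_mulVec, hjac,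
        jac_mulVec]
    have hcomp : HasDerivWithinAt (fun σ => αr P₀ E₀ ε (ε • n σ))
        (fderiv ℝ (αr P₀ E₀ ε) (ε • n σ) (ε • n')) (Set.Ico 0 U) σ :=
      HasFDerivAt.comp_hasDerivWithinAt (f := fun σ => ε • n σ) σ hdiff.hasFDerivAt
        (hn.const_smul ε)
    have hR : HasDerivWithinAt (fun σ => m σ i + κ i * σ * m σ 0)
        ((RMaj P₀ σ).mulVec (γ P₀ E₀ (ε • n σ) (n σ)) i + (κ i * 1 * m σ 0
          + κ i * σ * (RMaj P₀ σ).mulVec (γ P₀ E₀ (ε • n σ) (n σ)) 0)) (Set.Ico 0 U) σ :=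
      (hm i).add ((((hasDerivWithinAt_id σ _).const_mul (κ i))).mul (hm 0))
    simp only [hα, RMaj_mulVec, Pi.add_apply]
    have := ((hasDerivWithinAt_pi.1 hn i).sub ((hasDerivWithinAt_pi.1 ha i).add
      (hasDerivWithinAt_pi.1 hcomp i))).sub (hR.const_mul ε)
    refine this.congr_deriv ?_
    have hi := congrFun hlin i
    rw [hX] at hi
    simp only [Pi.sub_apply, Pi.add_apply, Pi.smul_apply, smul_eq_mul, RMaj_mul_RMaj_mulVec,
      deriv_RMaj_mulVec, ← hκ] at hi
    simp only [RMaj_mulVec, map_smul, Pi.smul_apply, smul_eq_mul, ← hκ, hκ0]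
    linear_combination hi
  have := eq_of_hasDerivWithinAt_zero h hτ
  simp only [hmn.n_zero, hmn.m_zero, hℓ₀, Matrix.mulVec_zero, Pi.zero_apply] at this
  linarith

end Estimators

/-! ### The a priori estimate -/

/-- The assumptions on the averaged data and on the estimators. -/
structure EstimatorData (P₀ E₀ Y₀ ε U : ℝ) (R : ℝ → Mat) (K a₀ : ℝ → Vec) (ℓ₀ : Vec)
    (m n : ℝ → Vec) : Prop where
  P_pos : 0 < P₀
  E_pos : 0 < E₀
  E_lt_one : E₀ < 1
  ε_pos : 0 < ε
  isR : IsR P₀ E₀ Y₀ U R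
  isK : IsK P₀ E₀ Y₀ U K
  contDiffOn_a₀ : ContDiffOn ℝ 2 a₀ (Set.Ico 0 U)
  abs_le_a₀ : ∀ τ ∈ Set.Ico 0 U, ∀ θ : ℝ, ∀ i,
    |(sAux f (J P₀ E₀ Y₀ τ) θ - (R τ).mulVec (sAux f ![P₀, E₀, Y₀] 0) - K τ) i| ≤ a₀ τ i
  α_ℓ₀ : α P₀ E₀ ε a₀ 0 (ε • ℓ₀) = ℓ₀
  solves : SolvesEstimatorSystem P₀ E₀ ε U a₀ ℓ₀ m n
  domain : MeetsDomainConditions P₀ E₀ ε U a₀ n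

/-- `x` solves `x' = ε f(x, 2πt)`, `x(0) = I₀` on the closed interval `[0, t₁]` and
`|x - J| ≤ ε n` there. -/
structure SolutionInTube (P₀ E₀ Y₀ ε t₁ : ℝ) (n : ℝ → Vec) (x : ℝ → Vec) : Prop where
  zero : x 0 = ![P₀, E₀, Y₀]
  deriv : ∀ t ∈ Set.Icc 0 t₁, HasDerivWithinAt x (satelliteField ε t (x t)) (Set.Icc 0 t₁) t
  le : ∀ t ∈ Set.Icc 0 t₁, ∀ i, |x t i - J P₀ E₀ Y₀ (ε * t) i| ≤ ε * n (ε * t) i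

/-- The quantity `(x - J)/ε - s + K + ε (w - M v) + R s(I₀, 0)`, where `M = ∂f̄/∂I (J)`. Its
derivative along a solution of the satellite system is of order `ε`. -/
noncomputable def defect (P₀ E₀ Y₀ ε : ℝ) (R : ℝ → Mat) (K x : ℝ → Vec) (t : ℝ) (i : Fin 3) : ℝ :=
  (x t i - J P₀ E₀ Y₀ (ε * t) i) / ε - ev (S i) (x t) (2 * π * t) / 960 + K (ε * t) i
    + ε * (ev (W i) (x t) (2 * π * t) / 77414400
      - onY (6 * π / P₀ ^ 3) i * (ev V (x t) (2 * π * t) / (2 * π * 57600)))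
    + (R (ε * t)).mulVec (sAux f ![P₀, E₀, Y₀] 0) i

section APriori

variable {P₀ E₀ Y₀ ε U : ℝ} {R : ℝ → Mat} {K a₀ : ℝ → Vec} {ℓ₀ : Vec} {m n x : ℝ → Vec}

lemma J_mem_tube (P₀ E₀ Y₀ τ : ℝ) {r : Vec} (h0 : 0 ≤ r 0) (h1 : 0 ≤ r 1) :
    J P₀ E₀ Y₀ τ ∈ tube P₀ E₀ r := by
  simp [tube, J, h0, h1]

lemma mem_tube_of_abs_le {τ : ℝ} {r I : Vec} (h : ∀ i, |I i - J P₀ E₀ Y₀ τ i| ≤ r i) :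
    I ∈ tube P₀ E₀ r := by
  have h0 := abs_le.1 (h 0)
  have h1 := abs_le.1 (h 1)
  simp only [J, Matrix.cons_val_zero, Matrix.cons_val_one] at h0 h1
  exact ⟨by linarith, by linarith, by linarith, by linarith⟩

lemma hasDerivWithinAt_comp_mul {g : ℝ → ℝ} {g' ε U t₁ t : ℝ} (hε : 0 < ε) (ht₁ : ε * t₁ < U)
    (hg : HasDerivWithinAt g g' (Set.Ico 0 U) (ε * t)) :
    HasDerivWithinAt (fun t => g (ε * t)) (g' * ε) (Set.Icc 0 t₁) t := by
  have hmaps : Set.MapsTo (fun t => ε * t) (Set.Icc 0 t₁) (Set.Ico 0 U) := fun s hs =>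
    ⟨mul_nonneg hε.le hs.1, (mul_le_mul_of_nonneg_left hs.2 hε.le).trans_lt ht₁⟩
  have h : HasDerivWithinAt (fun t => ε * t) ε (Set.Icc 0 t₁) t := by
    simpa using (hasDerivWithinAt_id t (Set.Icc 0 t₁)).const_mul ε
  exact hg.comp t h hmaps

/-- The derivative of a trigonometric polynomial along a solution of the satellite system. -/
lemma hasDerivWithinAt_ev_solution {s : Set ℝ} {t : ℝ} (A : TrigPoly)
    (hx : HasDerivWithinAt x (satelliteField ε t (x t)) s t) (hP : x t 0 ≠ 0) (hE : x t 1 ≠ 0) :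
    HasDerivWithinAt (fun t => ev A (x t) (2 * π * t))
      (ε * (π / 16) * ev (lie A) (x t) (2 * π * t) + 2 * π * ev (dθ A) (x t) (2 * π * t)) s t := by
  have hφ : HasDerivWithinAt (fun t => 2 * π * t) (2 * π) s t := by
    simpa using (hasDerivWithinAt_id t s).const_mul (2 * π)
  refine (hasDerivWithinAt_ev A hx hφ hP hE).congr_deriv ?_
  simp only [ev_lie A hP hE, satelliteField, Pi.smul_apply, smul_eq_mul, f_apply hP hE,
    Fin.sum_univ_three]
  ring

lemma J_apply (P₀ E₀ Y₀ τ : ℝ) (i : Fin 3) :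
    J P₀ E₀ Y₀ τ i = ![P₀, E₀, Y₀] i + onY (-(3 * π / P₀ ^ 2)) i * τ := by
  fin_cases i <;> simp [J, onY]
  ring

lemma SolutionInTube.mem_tube {t₁ : ℝ} (hx : SolutionInTube P₀ E₀ Y₀ ε t₁ n x) {t : ℝ}
    (ht : t ∈ Set.Icc 0 t₁) : x t ∈ tube P₀ E₀ (ε • n (ε * t)) :=
  mem_tube_of_abs_le (hx.le t ht)

namespace EstimatorData

variable (H : EstimatorData P₀ E₀ Y₀ ε U R K a₀ ℓ₀ m n)
include H

lemma n_pos {τ : ℝ} (hτ : τ ∈ Set.Ico 0 U) (i : Fin 3) : 0 < n τ i := by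
  obtain ⟨⟨h0, -⟩, ⟨h1, -⟩, h2, -⟩ := H.domain τ hτ
  have := H.ε_pos
  fin_cases i
  · exact pos_of_mul_pos_right h0 this.le
  · exact pos_of_mul_pos_right h1 this.le
  · exact h2

lemma J_ne_zero (τ : ℝ) : J P₀ E₀ Y₀ τ 0 ≠ 0 ∧ J P₀ E₀ Y₀ τ 1 ≠ 0 :=
  ⟨H.P_pos.ne', H.E_pos.ne'⟩

lemma hasDerivWithinAt_K {τ : ℝ} (hτ : τ ∈ Set.Ico 0 U) (i : Fin 3) :
    HasDerivWithinAt (fun σ => K σ i) (onY (6 * π / P₀ ^ 3) i * K τ 0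
      + π / 15360 * ev (meanPart (Pl i)) (J P₀ E₀ Y₀ τ) 0) (Set.Ico 0 U) τ := by
  obtain ⟨h0, h1⟩ := H.J_ne_zero τ
  refine (hasDerivWithinAt_pi.1 (H.isK.2 τ hτ) i).congr_deriv ?_
  rw [Pi.add_apply, avg_pAux_f_apply h0 h1, jac_avg_f h0 h1]
  fin_cases i <;> simp [Matrix.mulVec, dotProduct, Fin.sum_univ_three, onY, J]

lemma hasDerivWithinAt_R_mulVec {τ : ℝ} (hτ : τ ∈ Set.Ico 0 U) (v : Vec) (i : Fin 3) :
    HasDerivWithinAt (fun σ => (R σ).mulVec v i)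
      (onY (6 * π / P₀ ^ 3) i * (R τ).mulVec v 0) (Set.Ico 0 U) τ := by
  obtain ⟨h0, h1⟩ := H.J_ne_zero τ
  have h := fun j => (H.isR.2 τ hτ i j).mul_const (v j)
  simp only [Matrix.mulVec, dotProduct, Fin.sum_univ_three]
  refine (((h 0).add (h 1)).add (h 2)).congr_deriv ?_
  rw [jac_avg_f h0 h1]
  fin_cases i <;> simp [Matrix.mul_apply, Fin.sum_univ_three, onY, J]
  ring

lemma tube_pos {τ : ℝ} (hτ : τ ∈ Set.Ico 0 U) :
    0 < P₀ - (ε • n τ) 0 ∧ 0 < E₀ - (ε • n τ) 1 := by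
  obtain ⟨⟨-, h0⟩, ⟨-, h1⟩, -⟩ := H.domain τ hτ
  exact ⟨sub_pos.2 h0, sub_pos.2 (h1.trans_le (min_le_left _ _))⟩

lemma mul_mem_Ico {t₁ t : ℝ} (ht₁ : ε * t₁ < U) (ht : t ∈ Set.Icc 0 t₁) :
    ε * t ∈ Set.Ico 0 U :=
  ⟨mul_nonneg H.ε_pos.le ht.1, (mul_le_mul_of_nonneg_left ht.2 H.ε_pos.le).trans_lt ht₁⟩

variable {t₁ : ℝ} (hx : SolutionInTube P₀ E₀ Y₀ ε t₁ n x) (ht₁ : ε * t₁ < U)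
include hx ht₁

lemma ne_zero {t : ℝ} (ht : t ∈ Set.Icc 0 t₁) : x t 0 ≠ 0 ∧ x t 1 ≠ 0 := by
  obtain ⟨h0, h1⟩ := H.tube_pos (H.mul_mem_Ico ht₁ ht)
  obtain ⟨h2, -, h3, -⟩ := hx.mem_tube ht
  exact ⟨(h0.trans_le h2).ne', (h1.trans_le h3).ne'⟩

/-- The derivative of the defect, see `defect`. The first two terms come from the expansion of `f̄`
at `J`, the third one from that of `p̄`, and the last one is `ε² (u - M (q + w))`. -/
lemma hasDerivWithinAt_defect {t : ℝ} (ht : t ∈ Set.Icc 0 t₁) (i : Fin 3) :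
    HasDerivWithinAt (fun t => defect P₀ E₀ Y₀ ε R K x t i)
      (onY (3 * π / P₀ ^ 2 - 3 * π / x t 0 ^ 2 - 6 * π / P₀ ^ 3 * (x t 0 - P₀)) i
        + ε * (onY (6 * π / P₀ ^ 3) i * defect P₀ E₀ Y₀ ε R K x t 0)
        + ε * (π / 15360 * (ev (meanPart (Pl i)) (J P₀ E₀ Y₀ (ε * t)) 0
          - ev (meanPart (Pl i)) (x t) 0))
        + ε ^ 2 * (π / (16 * 77414400) * ev (lie (W i)) (x t) (2 * π * t)
          - onY (6 * π / P₀ ^ 3) i * ((ev (W 0) (x t) (2 * π * t)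
            + 42 * ev (lie V) (x t) (2 * π * t)) / 77414400)))
      (Set.Icc 0 t₁) t := by
  obtain ⟨h0, h1⟩ := H.ne_zero hx ht₁ ht
  have hτ := H.mul_mem_Ico ht₁ ht
  have hε := H.ε_pos
  have hd := hx.deriv t ht
  have hJ : HasDerivWithinAt (fun t => J P₀ E₀ Y₀ (ε * t) i) (onY (-(3 * π / P₀ ^ 2)) i * ε)
      (Set.Icc 0 t₁) t := by
    simp only [J_apply P₀ E₀ Y₀ _ i]
    simpa using ((((hasDerivWithinAt_id t (Set.Icc 0 t₁)).const_mul ε).const_mul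
      (onY (-(3 * π / P₀ ^ 2)) i)).const_add (![P₀, E₀, Y₀] i))
  have hS := hasDerivWithinAt_ev_solution (S i) hd h0 h1
  have hW := hasDerivWithinAt_ev_solution (W i) hd h0 h1
  have hV := hasDerivWithinAt_ev_solution V hd h0 h1
  have hK := hasDerivWithinAt_comp_mul hε ht₁ (H.hasDerivWithinAt_K hτ i)
  have hR := hasDerivWithinAt_comp_mul hε ht₁
    (H.hasDerivWithinAt_R_mulVec hτ (sAux f ![P₀, E₀, Y₀] 0) i)
  have hxi := hasDerivWithinAt_pi.1 hd i
  have hD := (((((hxi.sub hJ).div_const ε).sub (hS.div_const 960)).add hK).add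
    (((hW.div_const 77414400).sub
      ((hV.div_const (2 * π * 57600)).const_mul (onY (6 * π / P₀ ^ 3) i))).const_mul ε)).add hR
  refine hD.congr_deriv ?_
  have hF : π / 8 * ev (meanPart (F i)) (x t) (2 * π * t) = onY (-(3 * π / x t 0 ^ 2)) i := by
    rw [ev_meanPart _ _ _ 0, ← avg_f_apply h0 h1, avg_f h0 h1, onY]
  have hf : satelliteField ε t (x t) i = ε * (onY (-(3 * π / x t 0 ^ 2)) i
      + π / 8 * ev (oscPart (F i)) (x t) (2 * π * t)) := by
    rw [← hF, ← mul_add, ev_meanPart_add_oscPart, ← f_apply h0 h1]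
    rfl
  have hPl := ev_meanPart_add_oscPart (Pl i) (x t) (2 * π * t)
  rw [ev_meanPart _ _ _ 0] at hPl
  have hJ0 : J P₀ E₀ Y₀ (ε * t) 0 = P₀ := rfl
  have hY0 : onY (6 * π / P₀ ^ 3) 0 = 0 := rfl
  have hlie : lie (S i) = Pl i := rfl
  rw [hf, ev_dθ_S, ev_dθ_W i h0 h1, ev_dθ_V h0 h1, hlie, ← hPl]
  simp only [defect, hJ0, hY0]
  rw [onY_apply (-(3 * π / x t 0 ^ 2)), onY_apply (-(3 * π / P₀ ^ 2)), onY_apply (6 * π / P₀ ^ 3),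
    onY_apply (3 * π / P₀ ^ 2 - 3 * π / x t 0 ^ 2 - 6 * π / P₀ ^ 3 * (x t 0 - P₀))]
  have hπ := pi_pos
  have hP := H.P_pos
  field_simp
  ring

lemma defect_zero (h0 : 0 ≤ t₁) (i : Fin 3) : defect P₀ E₀ Y₀ ε R K x 0 i = 0 := by
  obtain ⟨h1, h2⟩ := H.ne_zero hx ht₁ ⟨le_rfl, h0⟩
  have hJ : J P₀ E₀ Y₀ 0 = ![P₀, E₀, Y₀] := by simp [J]
  rw [hx.zero] at h1 h2
  simp [defect, hx.zero, H.isK.1, H.isR.1, hJ, ev_W_zero, ev_V_zero, sAux_f_apply h1 h2]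

/-- The terms of the derivative of the defect which are quadratic in `ε` are strictly below `γ`. -/
lemma abs_deriv_defect_lt {t : ℝ} (ht : t ∈ Set.Icc 0 t₁)
    (hlt : |x t 0 - J P₀ E₀ Y₀ (ε * t) 0| < ε * n (ε * t) 0) (i : Fin 3) :
    |onY (3 * π / P₀ ^ 2 - 3 * π / x t 0 ^ 2 - 6 * π / P₀ ^ 3 * (x t 0 - P₀)) i
        + ε * (π / 15360 * (ev (meanPart (Pl i)) (J P₀ E₀ Y₀ (ε * t)) 0
          - ev (meanPart (Pl i)) (x t) 0))
        + ε ^ 2 * (π / (16 * 77414400) * ev (lie (W i)) (x t) (2 * π * t)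
          - onY (6 * π / P₀ ^ 3) i * ((ev (W 0) (x t) (2 * π * t)
            + 42 * ev (lie V) (x t) (2 * π * t)) / 77414400))|
      < ε ^ 2 * γ P₀ E₀ (ε • n (ε * t)) (n (ε * t)) i := by
  have hτ := H.mul_mem_Ico ht₁ ht
  have hε := H.ε_pos
  have hπ := pi_pos
  have hn := H.n_pos hτ
  obtain ⟨hPm, hEm⟩ := H.tube_pos hτ
  have htube := hx.mem_tube ht
  have hJtube : J P₀ E₀ Y₀ (ε * t) ∈ tube P₀ E₀ (ε • n (ε * t)) :=
    J_mem_tube _ _ _ _ (by have := hn 0; simp; positivity) (by have := hn 1; simp; positivity)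
  set r := ε • n (ε * t) with hr
  have hrj (j : Fin 3) : r j = ε * n (ε * t) j := rfl
  have hEp : 0 < E₀ + r 1 := by
    have := H.E_pos; have := hn 1; rw [hrj]; positivity
  have hc := abs_u_le hPm H.P_pos hEm htube (2 * π * t) i
  have hp := abs_ev_sub_le (meanPart (Pl i)) 0 hPm hEm
    (fun I h0 h0' h1 h1' j => abs_dpbar_le hPm hEm ⟨h0, h0', h1, h1'⟩ 0 i j) hJtube htube
  have hd (j : Fin 3) : 0 ≤ dMaj P₀ E₀ r i j := by
    have := (abs_nonneg _).trans (abs_dpbar_le hPm hEm htube 0 i j)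
    exact nonneg_of_mul_nonneg_right this (by positivity)
  have hd0 : 0 < dMaj P₀ E₀ r i 0 := by
    fin_cases i <;> simp [dMaj] <;> positivity
  have hpd : |π / 15360 * (ev (meanPart (Pl i)) (J P₀ E₀ Y₀ (ε * t)) 0
      - ev (meanPart (Pl i)) (x t) 0)| < ε * ∑ j, dMaj P₀ E₀ r i j * n (ε * t) j := by
    rw [abs_mul, abs_of_pos (by positivity : 0 < π / 15360)]
    calc _ ≤ π / 15360 * ∑ j, 15360 / π * dMaj P₀ E₀ r i j * |J P₀ E₀ Y₀ (ε * t) j - x t j| := by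
          gcongr
      _ = ∑ j, dMaj P₀ E₀ r i j * |x t j - J P₀ E₀ Y₀ (ε * t) j| := by
          rw [Finset.mul_sum]
          refine Finset.sum_congr rfl fun j _ => ?_
          rw [abs_sub_comm]
          field_simp
      _ < ∑ j, dMaj P₀ E₀ r i j * (ε * n (ε * t) j) :=
          Finset.sum_lt_sum (fun j _ => mul_le_mul_of_nonneg_left (hx.le t ht j) (hd j))
            ⟨0, Finset.mem_univ _, mul_lt_mul_of_pos_left hlt hd0⟩
      _ = _ := by
          rw [Finset.mul_sum]
          exact Finset.sum_congr rfl fun j _ => by ring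
  have hquad : |onY (3 * π / P₀ ^ 2 - 3 * π / x t 0 ^ 2 - 6 * π / P₀ ^ 3 * (x t 0 - P₀)) i|
      ≤ ε ^ 2 * (1 / 2 * ∑ j, ∑ k, eMaj P₀ r i j k * n (ε * t) j * n (ε * t) k) := by
    have hx0 := hx.le t ht 0
    have hq := abs_favgY_remainder_le (a := P₀) (x := x t 0) hPm
      (by have := hn 0; rw [hrj]; nlinarith) htube.1
    fin_cases i
    · simp [onY, eMaj]
    · simp [onY, eMaj]
    · simp only [onY, eMaj, Fin.sum_univ_three, Fin.reduceFinMk, Matrix.cons_val]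
      simp
      refine hq.trans ?_
      have : |x t 0 - P₀| ≤ ε * n (ε * t) 0 := hx0
      have hn0 := hn 0
      calc _ ≤ 1 / 2 * (18 * π / (P₀ - r 0) ^ 4 * (ε * n (ε * t) 0) * (ε * n (ε * t) 0)) := by
            gcongr
        _ = _ := by ring
  set A := onY (3 * π / P₀ ^ 2 - 3 * π / x t 0 ^ 2 - 6 * π / P₀ ^ 3 * (x t 0 - P₀)) i
  set B := π / 15360 * (ev (meanPart (Pl i)) (J P₀ E₀ Y₀ (ε * t)) 0
      - ev (meanPart (Pl i)) (x t) 0)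
  set C := π / (16 * 77414400) * ev (lie (W i)) (x t) (2 * π * t)
      - onY (6 * π / P₀ ^ 3) i * ((ev (W 0) (x t) (2 * π * t)
        + 42 * ev (lie V) (x t) (2 * π * t)) / 77414400)
  calc |A + ε * B + ε ^ 2 * C| ≤ |A| + |ε * B| + |ε ^ 2 * C| :=
        (abs_add_le _ _).trans (by gcongr; exact abs_add_le _ _)
    _ = |A| + ε * |B| + ε ^ 2 * |C| := by
        rw [abs_mul ε, abs_mul (ε ^ 2), abs_of_pos hε, abs_of_pos (pow_pos hε 2)]
    _ < ε ^ 2 * (1 / 2 * ∑ j, ∑ k, eMaj P₀ r i j k * n (ε * t) j * n (ε * t) k)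
        + ε * (ε * ∑ j, dMaj P₀ E₀ r i j * n (ε * t) j) + ε ^ 2 * cMaj P₀ E₀ r i :=
        add_lt_add_of_lt_of_le (add_lt_add_of_le_of_lt hquad (mul_lt_mul_of_pos_left hpd hε))
          (mul_le_mul_of_nonneg_left hc (by positivity))
    _ = _ := by
        simp only [γ]
        ring

end EstimatorData

lemma pos_of_hasDerivWithinAt_pos {g g' : ℝ → ℝ} {T : ℝ} (h0 : g 0 = 0)
    (hg : ∀ t ∈ Set.Icc 0 T, HasDerivWithinAt g (g' t) (Set.Icc 0 T) t)
    (hpos : ∀ t ∈ Set.Ioo 0 T, 0 < g' t) {t : ℝ} (ht : t ∈ Set.Ioc 0 T) : 0 < g t := by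
  have hmono : StrictMonoOn g (Set.Icc 0 T) := by
    refine strictMonoOn_of_deriv_pos (convex_Icc 0 T) (fun t ht => (hg t ht).continuousWithinAt)
      fun t ht => ?_
    rw [interior_Icc] at ht
    rw [((hg t (Set.Ioo_subset_Icc_self ht)).hasDerivAt (Icc_mem_nhds ht.1 ht.2)).deriv]
    exact hpos t ht
  have := hmono ⟨le_rfl, ht.1.le.trans ht.2⟩ ⟨ht.1.le, ht.2⟩ ht.1
  rwa [h0] at this

namespace EstimatorData

variable (H : EstimatorData P₀ E₀ Y₀ ε U R K a₀ ℓ₀ m n)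
include H

lemma hasDerivWithinAt_RMaj_m {t₁ t : ℝ} (ht₁ : ε * t₁ < U) (ht : t ∈ Set.Icc 0 t₁) (i : Fin 3) :
    HasDerivWithinAt (fun t => ε * (RMaj P₀ (ε * t)).mulVec (m (ε * t)) i)
      (ε ^ 2 * (γ P₀ E₀ (ε • n (ε * t)) (n (ε * t)) i + onY (6 * π / P₀ ^ 3) i *
        (m (ε * t) 0 + 2 * (ε * t) * γ P₀ E₀ (ε • n (ε * t)) (n (ε * t)) 0)))
      (Set.Icc 0 t₁) t := by
  have hτ := H.mul_mem_Ico ht₁ ht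
  have hm (j : Fin 3) := hasDerivWithinAt_comp_mul H.ε_pos ht₁
    (hasDerivWithinAt_pi.1 (H.solves.m_deriv _ hτ) j)
  have hid : HasDerivWithinAt (fun t => ε * t) ε (Set.Icc 0 t₁) t := by
    simpa using (hasDerivWithinAt_id t (Set.Icc 0 t₁)).const_mul ε
  simp only [RMaj_mulVec]
  refine (((hm i).add ((hid.const_mul (onY (6 * π / P₀ ^ 3) i)).mul (hm 0))).const_mul
    ε).congr_deriv ?_
  have hY0 : onY (6 * π / P₀ ^ 3) 0 = 0 := rfl
  simp only [RMaj_mulVec, hY0]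
  ring

variable {t₁ : ℝ} (hx : SolutionInTube P₀ E₀ Y₀ ε t₁ n x) (ht₁ : ε * t₁ < U)
  (hlt : ∀ t ∈ Set.Ico 0 t₁, |x t 0 - J P₀ E₀ Y₀ (ε * t) 0| < ε * n (ε * t) 0)
include hx ht₁ hlt

/-- Comparison of the derivatives of the defect and of `ε R m`. The derivative of the defect
involves its `P` component, through the off-diagonal entry of `∂f̄/∂I`; this component is assumed
to be estimated already. -/
lemma abs_defect_lt_of_le {i : Fin 3}
    (hκ : ∀ t ∈ Set.Ioo 0 t₁, onY (6 * π / P₀ ^ 3) i * |defect P₀ E₀ Y₀ ε R K x t 0|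
      ≤ onY (6 * π / P₀ ^ 3) i * (ε * m (ε * t) 0)) {t : ℝ} (ht : t ∈ Set.Ioc 0 t₁) :
    |defect P₀ E₀ Y₀ ε R K x t i| < ε * (RMaj P₀ (ε * t)).mulVec (m (ε * t)) i := by
  have ht₁0 : 0 ≤ t₁ := ht.1.le.trans ht.2
  have hκ0 : 0 ≤ onY (6 * π / P₀ ^ 3) i :=
    onY_nonneg (by have := H.P_pos; have := pi_pos; positivity) i
  have hε := H.ε_pos
  have hm0 : ε * (RMaj P₀ (ε * 0)).mulVec (m (ε * 0)) i = 0 := by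
    simp [H.solves.m_zero]
  have hd0 := H.defect_zero hx ht₁ ht₁0 i
  have key (t : ℝ) (ht : t ∈ Set.Ioo 0 t₁) :
      0 ≤ ε ^ 2 * (2 * (ε * t) * γ P₀ E₀ (ε • n (ε * t)) (n (ε * t)) 0) ∧
      |ε * (onY (6 * π / P₀ ^ 3) i * defect P₀ E₀ Y₀ ε R K x t 0)|
        ≤ ε ^ 2 * (onY (6 * π / P₀ ^ 3) i * m (ε * t) 0) := by
    have htc : t ∈ Set.Icc 0 t₁ := Set.Ioo_subset_Icc_self ht
    have hγ := (abs_nonneg _).trans_lt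
      (H.abs_deriv_defect_lt hx ht₁ htc (hlt t ⟨ht.1.le, ht.2⟩) 0)
    have hγ : 0 < γ P₀ E₀ (ε • n (ε * t)) (n (ε * t)) 0 :=
      pos_of_mul_pos_right hγ (by positivity)
    have ht0 := ht.1
    refine ⟨by positivity, ?_⟩
    rw [abs_mul, abs_mul, abs_of_pos hε, abs_of_nonneg hκ0]
    have := mul_le_mul_of_nonneg_left (hκ t ht) hε.le
    linarith
  have hD := fun t ht => H.hasDerivWithinAt_defect hx ht₁ (t := t) ht i
  have hN := fun t ht => H.hasDerivWithinAt_RMaj_m ht₁ (t := t) ht i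
  have h1 := pos_of_hasDerivWithinAt_pos (g := fun t =>
      ε * (RMaj P₀ (ε * t)).mulVec (m (ε * t)) i - defect P₀ E₀ Y₀ ε R K x t i)
    (by simp only [hd0, hm0, sub_zero])
    (fun t ht => (hN t ht).sub (hD t ht)) (fun t ht => by
      obtain ⟨k1, k2⟩ := key t ht
      have k1 := mul_nonneg hκ0 k1
      have k3 := (abs_lt.1 (H.abs_deriv_defect_lt hx ht₁ (Set.Ioo_subset_Icc_self ht)
        (hlt t ⟨ht.1.le, ht.2⟩) i)).2
      have k4 := (abs_le.1 k2).2
      linarith) ht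
  have h2 := pos_of_hasDerivWithinAt_pos (g := fun t =>
      ε * (RMaj P₀ (ε * t)).mulVec (m (ε * t)) i + defect P₀ E₀ Y₀ ε R K x t i)
    (by simp only [hd0, hm0, add_zero])
    (fun t ht => (hN t ht).add (hD t ht)) (fun t ht => by
      obtain ⟨k1, k2⟩ := key t ht
      have k1 := mul_nonneg hκ0 k1
      have k3 := (abs_lt.1 (H.abs_deriv_defect_lt hx ht₁ (Set.Ioo_subset_Icc_self ht)
        (hlt t ⟨ht.1.le, ht.2⟩) i)).1
      have k4 := (abs_le.1 k2).1
      linarith) ht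
  exact abs_lt.2 ⟨by linarith, by linarith⟩

/-- The bound of the `P` component needs no other component and yields the assumption of
`abs_defect_lt_of_le`. -/
lemma abs_defect_lt (i : Fin 3) {t : ℝ} (ht : t ∈ Set.Ioc 0 t₁) :
    |defect P₀ E₀ Y₀ ε R K x t i| < ε * (RMaj P₀ (ε * t)).mulVec (m (ε * t)) i := by
  refine H.abs_defect_lt_of_le hx ht₁ hlt (fun t ht => ?_) ht
  have h := H.abs_defect_lt_of_le hx ht₁ hlt (i := 0) (fun t _ => by simp [onY])
    (Set.Ioo_subset_Ioc_self ht)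
  rw [RMaj_mulVec] at h
  simp only [onY, Matrix.cons_val_zero, zero_mul, add_zero] at h
  exact mul_le_mul_of_nonneg_left h.le
    (onY_nonneg (by have := H.P_pos; have := pi_pos; positivity) i)

/-- The solution cannot reach the boundary of the tube at the time `t₁`: the strict bound of the
defect makes the integral-type inequality for `|x - J|` strict. -/
lemma abs_sub_lt (h0 : 0 < t₁) (i : Fin 3) :
    |x t₁ i - J P₀ E₀ Y₀ (ε * t₁) i| < ε * n (ε * t₁) i := by
  have ht : t₁ ∈ Set.Icc 0 t₁ := ⟨h0.le, le_rfl⟩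
  have hτ := H.mul_mem_Ico ht₁ ht
  have hε := H.ε_pos
  have hn := H.n_pos hτ
  obtain ⟨hPm, hEm⟩ := H.tube_pos hτ
  have htube := hx.mem_tube ht
  have hJtube : J P₀ E₀ Y₀ (ε * t₁) ∈ tube P₀ E₀ (ε • n (ε * t₁)) :=
    J_mem_tube _ _ _ _ (by have := hn 0; simp; positivity) (by have := hn 1; simp; positivity)
  obtain ⟨hJ0, hJ1⟩ := H.J_ne_zero (ε * t₁)
  have hD := H.abs_defect_lt hx ht₁ hlt i ⟨h0, le_rfl⟩
  have hneq := n_eq_α_add H.P_pos H.contDiffOn_a₀ H.α_ℓ₀ H.solves H.domain hτ i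
  have ha := H.abs_le_a₀ _ hτ (2 * π * t₁) i
  rw [Pi.sub_apply, Pi.sub_apply, sAux_f_apply hJ0 hJ1] at ha
  have hw := abs_w_le hPm H.P_pos hEm htube (2 * π * t₁) i
  have hs := abs_ev_sub_le (S i) (2 * π * t₁) hPm hEm
    (fun I h0 h0' h1 h1' j => abs_ds_le hPm hEm ⟨h0, h0', h1, h1'⟩ (2 * π * t₁) i j) htube hJtube
  have hs' : |ev (S i) (x t₁) (2 * π * t₁) - ev (S i) (J P₀ E₀ Y₀ (ε * t₁)) (2 * π * t₁)|
      ≤ 960 * (aMaj P₀ E₀ (ε • n (ε * t₁))).mulVec (ε • n (ε * t₁)) i := by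
    refine hs.trans ?_
    rw [Matrix.mulVec, dotProduct, Finset.mul_sum]
    refine Finset.sum_le_sum fun j _ => ?_
    rw [← mul_assoc]
    exact mul_le_mul_of_nonneg_left (hx.le t₁ ht j)
      ((abs_nonneg _).trans (abs_ds_le hPm hEm htube 0 i j))
  set L := x t₁ i - J P₀ E₀ Y₀ (ε * t₁) i with hL
  suffices hmain : |L / ε| < n (ε * t₁) i by
    rwa [abs_div, abs_of_pos hε, div_lt_iff₀ hε, mul_comm] at hmain
  rw [hneq]
  simp only [α, Pi.add_apply, Pi.smul_apply, smul_eq_mul]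
  rw [defect, ← hL] at hD
  set D := L / ε - ev (S i) (x t₁) (2 * π * t₁) / 960 + K (ε * t₁) i
    + ε * (ev (W i) (x t₁) (2 * π * t₁) / 77414400
      - onY (6 * π / P₀ ^ 3) i * (ev V (x t₁) (2 * π * t₁) / (2 * π * 57600)))
    + (R (ε * t₁)).mulVec (sAux f ![P₀, E₀, Y₀] 0) i with hDdef
  set w := ev (W i) (x t₁) (2 * π * t₁) / 77414400
      - onY (6 * π / P₀ ^ 3) i * (ev V (x t₁) (2 * π * t₁) / (2 * π * 57600))
  have hw' : |ε * w| ≤ ε * bMaj P₀ E₀ (ε • n (ε * t₁)) i := by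
    rw [abs_mul, abs_of_pos hε]
    gcongr
  rw [abs_lt] at hD ⊢
  rw [abs_le] at hw' hs' ha
  constructor <;> linarith [hD.1, hD.2, hw'.1, hw'.2, hs'.1, hs'.2, ha.1, ha.2]

end EstimatorData

end APriori

open scoped NNReal

/-! ### Existence and uniqueness -/

/-- The box `[Pm, Pp] × [Em, Ep] × ℝ`. -/
def box (Pm Pp Em Ep : ℝ) : Set Vec := {I | Pm ≤ I 0 ∧ I 0 ≤ Pp ∧ Em ≤ I 1 ∧ I 1 ≤ Ep}

section Field

variable {Pm Pp Em Ep : ℝ}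

lemma ne_zero_of_mem_box (hPm : 0 < Pm) (hEm : 0 < Em) {I : Vec} (hI : I ∈ box Pm Pp Em Ep) :
    I 0 ≠ 0 ∧ I 1 ≠ 0 :=
  ⟨(hPm.trans_le hI.1).ne', (hEm.trans_le hI.2.2.1).ne'⟩

lemma satelliteField_apply {ε t : ℝ} {I : Vec} (hP : I 0 ≠ 0) (hE : I 1 ≠ 0) (i : Fin 3) :
    satelliteField ε t I i = ε * (π / 8) * ev (F i) I (2 * π * t) := by
  rw [satelliteField, Pi.smul_apply, f_apply hP hE, smul_eq_mul, mul_assoc ε]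

lemma exists_lipschitzOnWith_satelliteField (ε : ℝ) (hPm : 0 < Pm) (hEm : 0 < Em) :
    ∃ C : ℝ≥0, ∀ t, LipschitzOnWith C (satelliteField ε t) (box Pm Pp Em Ep) := by
  choose C hC0 hC using fun i j =>
    exists_abs_ev_le (Pp := Pp) (Ep := Ep) (dI j (F i)) hPm hEm
  have hpos (i : Fin 3) : 0 ≤ |ε * (π / 8)| * ∑ j, C i j :=
    mul_nonneg (abs_nonneg _) (Finset.sum_nonneg fun j _ => hC0 i j)
  refine ⟨⟨∑ i, |ε * (π / 8)| * ∑ j, C i j, Finset.sum_nonneg fun i _ => hpos i⟩, fun t =>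
    LipschitzOnWith.of_dist_le_mul fun I hI I' hI' => ?_⟩
  obtain ⟨h0, h1⟩ := ne_zero_of_mem_box hPm hEm hI
  obtain ⟨h0', h1'⟩ := ne_zero_of_mem_box hPm hEm hI'
  refine (dist_pi_le_iff (mul_nonneg (NNReal.coe_nonneg _) dist_nonneg)).2 fun i => ?_
  rw [satelliteField_apply h0 h1, satelliteField_apply h0' h1', Real.dist_eq, ← mul_sub, abs_mul]
  have h := abs_ev_sub_le (F i) (2 * π * t) hPm hEm
    (fun I a b c d j => hC i j I (2 * π * t) a b c d) hI hI'
  calc _ ≤ |ε * (π / 8)| * ∑ j, C i j * |I j - I' j| := by gcongr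
    _ ≤ |ε * (π / 8)| * ∑ j, C i j * dist I I' := by
        gcongr with j
        · exact hC0 i j
        · exact dist_le_pi_dist I I' j
    _ = (|ε * (π / 8)| * ∑ j, C i j) * dist I I' := by rw [← Finset.sum_mul, mul_assoc]
    _ ≤ _ := by
        gcongr
        exact Finset.single_le_sum (f := fun i => |ε * (π / 8)| * ∑ j, C i j)
          (fun i _ => hpos i) (Finset.mem_univ i)

lemma exists_norm_satelliteField_le (ε : ℝ) (hPm : 0 < Pm) (hEm : 0 < Em) :
    ∃ L : ℝ≥0, ∀ t, ∀ I ∈ box Pm Pp Em Ep, ‖satelliteField ε t I‖ ≤ L := by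
  choose C hC0 hC using fun i =>
    exists_abs_ev_le (Pp := Pp) (Ep := Ep) (F i) hPm hEm
  have hpos (i : Fin 3) : 0 ≤ |ε * (π / 8)| * C i := mul_nonneg (abs_nonneg _) (hC0 i)
  refine ⟨⟨∑ i, |ε * (π / 8)| * C i, Finset.sum_nonneg fun i _ => hpos i⟩, fun t I hI => ?_⟩
  obtain ⟨h0, h1⟩ := ne_zero_of_mem_box hPm hEm hI
  refine (pi_norm_le_iff_of_nonneg (NNReal.coe_nonneg _)).2 fun i => ?_
  rw [satelliteField_apply h0 h1, Real.norm_eq_abs, abs_mul]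
  refine (mul_le_mul_of_nonneg_left (hC i I _ hI.1 hI.2.1 hI.2.2.1 hI.2.2.2)
    (abs_nonneg _)).trans ?_
  exact Finset.single_le_sum (f := fun i => |ε * (π / 8)| * C i)
    (fun i _ => hpos i) (Finset.mem_univ i)

/-- The nearest point projection onto the box. -/
def clamp (Pm Pp Em Ep : ℝ) (I : Vec) : Vec :=
  ![max Pm (min Pp (I 0)), max Em (min Ep (I 1)), I 2]

lemma clamp_mem_box (hP : Pm ≤ Pp) (hE : Em ≤ Ep) (I : Vec) :
    clamp Pm Pp Em Ep I ∈ box Pm Pp Em Ep := by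
  simp [clamp, box, hP, hE]

lemma clamp_of_mem_box {I : Vec} (hI : I ∈ box Pm Pp Em Ep) : clamp Pm Pp Em Ep I = I := by
  obtain ⟨h0, h1, h2, h3⟩ := hI
  ext i
  fin_cases i <;> simp [clamp, h0, h1, h2, h3]

lemma lipschitzWith_clamp : LipschitzWith 1 (clamp Pm Pp Em Ep) := by
  have h (a b : ℝ) : LipschitzWith 1 fun x : ℝ => max a (min b x) :=
    (LipschitzWith.id.const_min b).const_max a
  refine LipschitzWith.of_dist_le_mul fun I I' => (dist_pi_le_iff (by positivity)).2 fun i => ?_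
  have hi : dist (I i) (I' i) ≤ dist I I' := dist_le_pi_dist I I' i
  fin_cases i
  · exact ((h Pm Pp).dist_le_mul _ _).trans (by simpa using hi)
  · exact ((h Em Ep).dist_le_mul _ _).trans (by simpa using hi)
  · simpa [clamp] using hi

/-- The satellite field frozen outside a box is bounded and Lipschitz, hence its solutions are
global. -/
lemma exists_solution_clamp (ε : ℝ) (hPm : 0 < Pm) (hEm : 0 < Em) (hP : Pm ≤ Pp) (hE : Em ≤ Ep)
    (x₀ : Vec) {T : ℝ} (hT : 0 ≤ T) :
    ∃ x : ℝ → Vec, x 0 = x₀ ∧ ∀ t ∈ Set.Icc 0 T,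
      HasDerivWithinAt x (satelliteField ε t (clamp Pm Pp Em Ep (x t))) (Set.Icc 0 T) t := by
  obtain ⟨C, hC⟩ := exists_lipschitzOnWith_satelliteField (Pp := Pp) (Ep := Ep) ε hPm hEm
  obtain ⟨L, hL⟩ := exists_norm_satelliteField_le (Pp := Pp) (Ep := Ep) ε hPm hEm
  have hmem := clamp_mem_box hP hE
  have hpl : IsPicardLindelof (fun t x => satelliteField ε t (clamp Pm Pp Em Ep x))
      (⟨0, le_rfl, hT⟩ : Set.Icc 0 T) x₀ (L * ⟨T, hT⟩) 0 L (C * 1) :=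
    { lipschitzOnWith := fun t _ =>
        (hC t).comp (lipschitzWith_clamp.lipschitzOnWith) fun x _ => hmem x
      continuousOn := fun x _ => by
        obtain ⟨h0, h1⟩ := ne_zero_of_mem_box hPm hEm (hmem x)
        refine (continuous_pi fun i => ?_).continuousOn
        exact continuous_const.mul ((continuous_f_angle h0 h1 i).comp
          (continuous_const.mul continuous_id))
      norm_le := fun t _ x _ => hL t _ (hmem x)
      mul_max_le := by
        have : max (T - 0) (0 - 0) = T := by simp [hT]
        simp only [NNReal.coe_zero, sub_zero] at this ⊢
        rw [this]
        exact le_rfl }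
  exact hpl.exists_eq_forall_mem_Icc_hasDerivWithinAt₀

end Field

/-- A compact piece of a curve in `Λ` is contained in a box where `P` and `E` are bounded away
from zero. -/
lemma exists_box {T : ℝ} {y : ℝ → Vec} (hy : ContinuousOn y (Set.Icc 0 T))
    (hD : ∀ t ∈ Set.Icc 0 T, y t ∈ actionDomain) :
    ∃ Pm Pp Em, 0 < Pm ∧ 0 < Em ∧ ∀ t ∈ Set.Icc 0 T, y t ∈ box Pm Pp Em 1 := by
  rcases (Set.Icc 0 T).eq_empty_or_nonempty with h | h
  · exact ⟨1, 1, 1, one_pos, one_pos, by simp [h]⟩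
  have hi (i : Fin 3) : ContinuousOn (fun t => y t i) (Set.Icc 0 T) :=
    (continuous_apply i).comp_continuousOn hy
  obtain ⟨a, ha, ha'⟩ := isCompact_Icc.exists_isMinOn h (hi 0)
  obtain ⟨b, hb, hb'⟩ := isCompact_Icc.exists_isMaxOn h (hi 0)
  obtain ⟨c, hc, hc'⟩ := isCompact_Icc.exists_isMinOn h (hi 1)
  exact ⟨y a 0, y b 0, y c 1, (hD a ha).1, (hD c hc).2.1, fun t ht =>
    ⟨ha' ht, hb' ht, hc' ht, (hD t ht).2.2.le⟩⟩

lemma solution_unique {ε T : ℝ} {y z : ℝ → Vec}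
    (hy : ∀ t ∈ Set.Icc 0 T, HasDerivWithinAt y (satelliteField ε t (y t)) (Set.Icc 0 T) t)
    (hz : ∀ t ∈ Set.Icc 0 T, HasDerivWithinAt z (satelliteField ε t (z t)) (Set.Icc 0 T) t)
    (hyD : ∀ t ∈ Set.Icc 0 T, y t ∈ actionDomain) (hzD : ∀ t ∈ Set.Icc 0 T, z t ∈ actionDomain)
    (h0 : y 0 = z 0) : Set.EqOn y z (Set.Icc 0 T) := by
  have hyc : ContinuousOn y (Set.Icc 0 T) := fun t ht => (hy t ht).continuousWithinAt
  have hzc : ContinuousOn z (Set.Icc 0 T) := fun t ht => (hz t ht).continuousWithinAt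
  obtain ⟨a, b, c, ha, hc, hyb⟩ := exists_box hyc hyD
  obtain ⟨a', b', c', ha', hc', hzb⟩ := exists_box hzc hzD
  obtain ⟨C, hC⟩ := exists_lipschitzOnWith_satelliteField (Pp := max b b') (Ep := 1) ε
    (lt_min ha ha') (lt_min hc hc')
  have hright (g : ℝ → Vec) (g' : Vec) (t : ℝ) (ht : t ∈ Set.Ico 0 T)
      (hg : HasDerivWithinAt g g' (Set.Icc 0 T) t) : HasDerivWithinAt g g' (Set.Ici t) t :=
    hg.mono_of_mem_nhdsWithin (Icc_mem_nhdsGE_of_mem ht)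
  refine ODE_solution_unique_of_mem_Icc_right (v := satelliteField ε)
    (s := fun _ => box (min a a') (max b b') (min c c') 1) (fun t _ => hC t) hyc
    (fun t ht => hright _ _ _ ht (hy t (Set.Ico_subset_Icc_self ht))) (fun t ht => ?_) hzc
    (fun t ht => hright _ _ _ ht (hz t (Set.Ico_subset_Icc_self ht))) (fun t ht => ?_) h0
  · obtain ⟨k0, k1, k2, k3⟩ := hyb t (Set.Ico_subset_Icc_self ht)
    exact ⟨(min_le_left _ _).trans k0, k1.trans (le_max_left _ _), (min_le_left _ _).trans k2, k3⟩
  · obtain ⟨k0, k1, k2, k3⟩ := hzb t (Set.Ico_subset_Icc_self ht)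
    exact ⟨(min_le_right _ _).trans k0, k1.trans (le_max_right _ _), (min_le_right _ _).trans k2,
      k3⟩

lemma IsSolutionOn.hasDerivWithinAt_Icc {D : Set Vec} {G : ℝ → Vec → Vec} {x₀ : Vec} {T t : ℝ}
    {y : ℝ → Vec} (hy : IsSolutionOn D G x₀ T y) (ht : t < T) {s : ℝ} (hs : s ∈ Set.Icc 0 t) :
    HasDerivWithinAt y (G s (y s)) (Set.Icc 0 t) s :=
  (hy.2 s ⟨hs.1, hs.2.trans_lt ht⟩).2.mono fun _ hr => ⟨hr.1, hr.2.trans_lt ht⟩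

namespace EstimatorData

variable {P₀ E₀ Y₀ ε U : ℝ} {R : ℝ → Mat} {K a₀ : ℝ → Vec} {ℓ₀ : Vec} {m n : ℝ → Vec}
  (H : EstimatorData P₀ E₀ Y₀ ε U R K a₀ ℓ₀ m n)
include H

lemma continuousOn_n_comp {T : ℝ} (hT : ε * T < U) (i : Fin 3) :
    ContinuousOn (fun t => n (ε * t) i) (Set.Icc 0 T) := fun _ ht =>
  (hasDerivWithinAt_comp_mul H.ε_pos hT
    (hasDerivWithinAt_pi.1 (H.solves.n_deriv _ (H.mul_mem_Ico hT ht)) i)).continuousWithinAt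

lemma mem_actionDomain {t : ℝ} (ht : ε * t ∈ Set.Ico 0 U) {I : Vec}
    (h : ∀ i, |I i - J P₀ E₀ Y₀ (ε * t) i| ≤ ε * n (ε * t) i) : I ∈ actionDomain := by
  obtain ⟨⟨-, h0⟩, ⟨-, h1⟩, -⟩ := H.domain _ ht
  have k0 := abs_le.1 (h 0)
  have k1 := abs_le.1 (h 1)
  have h2 := h1.trans_le (min_le_left _ _)
  have h3 := h1.trans_le (min_le_right _ _)
  simp only [J, Matrix.cons_val_zero, Matrix.cons_val_one] at k0 k1
  exact ⟨by linarith, by linarith, by linarith⟩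

/-- The solution of the satellite system on a compact interval. As long as the solution of the
clamped system stays in the tube it solves the satellite system, and at the first time where it
touches the boundary of the tube `abs_sub_lt` would be violated. -/
lemma exists_solution_Icc {T : ℝ} (hT0 : 0 ≤ T) (hT : ε * T < U) :
    ∃ x : ℝ → Vec, SolutionInTube P₀ E₀ Y₀ ε T n x := by
  have hε := H.ε_pos
  have hnc := H.continuousOn_n_comp hT
  have hne : (Set.Icc 0 T).Nonempty := ⟨0, le_rfl, hT0⟩
  obtain ⟨a, ha, ha'⟩ := isCompact_Icc.exists_isMinOn hne
    (continuousOn_const (c := P₀) |>.sub ((hnc 0).const_smul ε))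
  obtain ⟨c, hc, hc'⟩ := isCompact_Icc.exists_isMinOn hne
    (continuousOn_const (c := E₀) |>.sub ((hnc 1).const_smul ε))
  set Pm := P₀ - ε • n (ε * a) 0
  set Em := E₀ - ε • n (ε * c) 1
  have hPm : 0 < Pm := (H.tube_pos (H.mul_mem_Ico hT ha)).1
  have hEm : 0 < Em := (H.tube_pos (H.mul_mem_Ico hT hc)).2
  have htube (t : ℝ) (ht : t ∈ Set.Icc 0 T) (I : Vec)
      (hI : ∀ i, |I i - J P₀ E₀ Y₀ (ε * t) i| ≤ ε * n (ε * t) i) : I ∈ box Pm (2 * P₀) Em 1 := by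
    obtain ⟨k0, k1, k2, k3⟩ := mem_tube_of_abs_le (r := ε • n (ε * t)) hI
    have hp := (H.tube_pos (H.mul_mem_Ico hT ht)).1
    have he := (H.mem_actionDomain (H.mul_mem_Ico hT ht) hI).2.2
    exact ⟨(ha' ht).trans k0, by linarith, (hc' ht).trans k2, he.le⟩
  have hJn (t : ℝ) (ht : t ∈ Set.Icc 0 T) :
      ∀ i, |J P₀ E₀ Y₀ (ε * t) i - J P₀ E₀ Y₀ (ε * t) i| ≤ ε * n (ε * t) i := fun i => by
    have := H.n_pos (H.mul_mem_Ico hT ht) i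
    simp only [sub_self, abs_zero]
    positivity
  have hbox0 := htube 0 ⟨le_rfl, hT0⟩ _ (hJn 0 ⟨le_rfl, hT0⟩)
  obtain ⟨x, hx0, hx⟩ := exists_solution_clamp ε hPm hEm (hbox0.1.trans hbox0.2.1)
    (hbox0.2.2.1.trans hbox0.2.2.2) ![P₀, E₀, Y₀] hT0
  have hxc (i : Fin 3) : ContinuousOn (fun t => x t i) (Set.Icc 0 T) := fun t ht =>
    ((hasDerivWithinAt_pi.1 (hx t ht)) i).continuousWithinAt
  have hJc (i : Fin 3) : Continuous fun t => J P₀ E₀ Y₀ (ε * t) i := by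
    simp only [J_apply P₀ E₀ Y₀ _ i]
    fun_prop
  have hgap (i : Fin 3) :
      ContinuousOn (fun t => |x t i - J P₀ E₀ Y₀ (ε * t) i|) (Set.Icc 0 T) :=
    ((hxc i).sub (hJc i).continuousOn).abs
  have hbnd (i : Fin 3) : ContinuousOn (fun t => ε * n (ε * t) i) (Set.Icc 0 T) :=
    continuousOn_const.mul (hnc i)
  have main : ∀ t ∈ Set.Icc 0 T, ∀ i, |x t i - J P₀ E₀ Y₀ (ε * t) i| < ε * n (ε * t) i := by
    by_contra! hcon
    set B : Set ℝ := ⋃ i, {t ∈ Set.Icc 0 T | ε * n (ε * t) i ≤ |x t i - J P₀ E₀ Y₀ (ε * t) i|}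
    have hBcl : IsClosed B :=
      isClosed_iUnion_of_finite fun i => isClosed_Icc.isClosed_le (hbnd i) (hgap i)
    have hBsub : B ⊆ Set.Icc 0 T := Set.iUnion_subset fun i t ht => ht.1
    have hBne : B.Nonempty := by
      obtain ⟨t, ht, i, hti⟩ := hcon
      exact ⟨t, Set.mem_iUnion.2 ⟨i, ht, hti⟩⟩
    obtain ⟨t₁, ht₁B, hmin⟩ := (isCompact_Icc.of_isClosed_subset hBcl hBsub).exists_isLeast hBne
    have ht₁ := hBsub ht₁B
    obtain ⟨i, -, hi⟩ := Set.mem_iUnion.1 ht₁B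
    have hpos : 0 < t₁ := by
      rcases ht₁.1.eq_or_lt with h | h
      · rw [← h, hx0] at hi
        have := H.n_pos (H.mul_mem_Ico hT ⟨le_rfl, hT0⟩) i
        have hJ0 : J P₀ E₀ Y₀ (ε * 0) = ![P₀, E₀, Y₀] := by simp [J]
        rw [hJ0, sub_self, abs_zero] at hi
        exact absurd hi (not_le.2 (by positivity))
      · exact h
    have hlt : ∀ t ∈ Set.Ico 0 t₁, ∀ i, |x t i - J P₀ E₀ Y₀ (ε * t) i| < ε * n (ε * t) i := by
      intro t ht i
      by_contra! h
      exact absurd (hmin (Set.mem_iUnion.2 ⟨i, ⟨ht.1, ht.2.le.trans ht₁.2⟩, h⟩)) (not_le.2 ht.2)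
    have hsub : Set.Icc 0 t₁ ⊆ Set.Icc 0 T := Set.Icc_subset_Icc_right ht₁.2
    have hle : ∀ t ∈ Set.Icc 0 t₁, ∀ i, |x t i - J P₀ E₀ Y₀ (ε * t) i| ≤ ε * n (ε * t) i := by
      intro t ht i
      rcases ht.2.eq_or_lt with rfl | h
      · have hcl : t ∈ closure (Set.Ico 0 t) := by
          rw [closure_Ico hpos.ne]
          exact ht
        have hsub' : Set.Ico 0 t ⊆ Set.Icc 0 T := Set.Ico_subset_Icc_self.trans hsub
        exact ContinuousWithinAt.closure_le hcl ((hgap i t ht₁).mono hsub')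
          ((hbnd i t ht₁).mono hsub') fun s hs => (hlt s hs i).le
      · exact (hlt t ⟨ht.1, h⟩ i).le
    have hsol : SolutionInTube P₀ E₀ Y₀ ε t₁ n x :=
      { zero := hx0
        deriv := fun t ht => by
          have := (hx t (hsub ht)).mono hsub
          rwa [clamp_of_mem_box (htube t (hsub ht) _ (hle t ht))] at this
        le := hle }
    exact absurd hi (not_le.2 (H.abs_sub_lt hsol
      ((mul_le_mul_of_nonneg_left ht₁.2 hε.le).trans_lt hT) (fun t ht => hlt t ht 0) hpos i))
  refine ⟨x, hx0, fun t ht => ?_, fun t ht i => (main t ht i).le⟩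
  have := hx t ht
  rwa [clamp_of_mem_box (htube t ht _ fun i => (main t ht i).le)] at this

lemma exists_isTheSolutionOn (hU0 : 0 < U) : ∃ I : ℝ → Vec,
    IsTheSolutionOn actionDomain (satelliteField ε) ![P₀, E₀, Y₀] (U / ε) I ∧
      ∀ t ∈ Set.Ico 0 (U / ε), ∀ i, |I t i - J P₀ E₀ Y₀ (ε * t) i| ≤ ε * n (ε * t) i := by
  have hε := H.ε_pos
  have hU {t : ℝ} (ht : t < U / ε) : ε * t < U := by rwa [mul_comm, ← lt_div_iff₀ hε]
  choose! x hx using fun (T : ℝ) (hT : T ∈ Set.Ico 0 (U / ε)) =>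
    H.exists_solution_Icc hT.1 (hU hT.2)
  have hmem {T t : ℝ} (hT : T ∈ Set.Ico 0 (U / ε)) (ht : t ∈ Set.Icc 0 T) :
      x T t ∈ actionDomain :=
    H.mem_actionDomain (H.mul_mem_Ico (hU hT.2) ht) ((hx T hT).le t ht)
  -- the solutions on different intervals agree
  have hagree {s T : ℝ} (hT : T ∈ Set.Ico 0 (U / ε)) (hs : s ∈ Set.Icc 0 T) : x s s = x T s := by
    have hs' : s ∈ Set.Ico 0 (U / ε) := ⟨hs.1, hs.2.trans_lt hT.2⟩
    have hsub : Set.Icc 0 s ⊆ Set.Icc 0 T := Set.Icc_subset_Icc_right hs.2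
    exact solution_unique (hx s hs').deriv (fun t ht => ((hx T hT).deriv t (hsub ht)).mono hsub)
      (fun t ht => hmem hs' ht) (fun t ht => hmem hT (hsub ht))
      ((hx s hs').zero.trans (hx T hT).zero.symm) ⟨hs.1, le_rfl⟩
  have hsol : ∀ t ∈ Set.Ico 0 (U / ε), x t t ∈ actionDomain ∧
      HasDerivWithinAt (fun t => x t t) (satelliteField ε t (x t t)) (Set.Ico 0 (U / ε)) t := by
    intro t ht
    refine ⟨hmem ht ⟨ht.1, le_rfl⟩, ?_⟩
    obtain ⟨T, htT, hTU⟩ := exists_between ht.2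
    have hT : T ∈ Set.Ico 0 (U / ε) := ⟨ht.1.trans htT.le, hTU⟩
    have htc : t ∈ Set.Icc 0 T := ⟨ht.1, htT.le⟩
    have h1 : HasDerivWithinAt (fun t => x t t) (satelliteField ε t (x t t)) (Set.Icc 0 T) t := by
      have := (hx T hT).deriv t htc
      rw [← hagree hT htc] at this
      exact this.congr_of_mem (fun s hs => hagree hT hs) htc
    refine h1.mono_of_mem_nhdsWithin ?_
    filter_upwards [self_mem_nhdsWithin, mem_nhdsWithin_of_mem_nhds (Iio_mem_nhds htT)] with s h h'
    exact ⟨h.1, le_of_lt h'⟩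
  refine ⟨fun t => x t t, ⟨⟨(hx 0 ⟨le_rfl, div_pos hU0 hε⟩).zero, hsol⟩, ?_⟩, fun t ht i =>
    (hx t ht).le t ⟨ht.1, le_rfl⟩ i⟩
  intro T' hT' y hy t ht
  have ht' : t ∈ Set.Ico 0 (U / ε) := ⟨ht.1, ht.2.trans_le hT'⟩
  exact solution_unique (fun s hs => hy.hasDerivWithinAt_Icc ht.2 hs) (hx t ht').deriv
    (fun s hs => (hy.2 s ⟨hs.1, hs.2.trans_lt ht.2⟩).1) (fun s hs => hmem ht' hs)
    (hy.1.trans (hx t ht').zero.symm) ⟨ht.1, le_rfl⟩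

end EstimatorData

/-- The averaged system conserves `P` and `E`, and `Y` decreases linearly. -/
lemma J_isTheSolutionOn {P₀ E₀ Y₀ : ℝ} (hP₀ : 0 < P₀) (hE₀ : 0 < E₀) (hE₀' : E₀ < 1) (T : ℝ) :
    IsTheSolutionOn actionDomain averagedField ![P₀, E₀, Y₀] T (J P₀ E₀ Y₀) := by
  refine ⟨⟨by simp [J], fun t _ => ⟨⟨hP₀, hE₀, hE₀'⟩, ?_⟩⟩, ?_⟩
  · refine hasDerivWithinAt_pi.2 fun i => ?_
    have : averagedField t (J P₀ E₀ Y₀ t) i = onY (-(3 * π / P₀ ^ 2)) i := by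
      rw [averagedField, avg_f (I := J P₀ E₀ Y₀ t) hP₀.ne' hE₀.ne']
      rfl
    rw [this]
    simp only [J_apply P₀ E₀ Y₀ _ i]
    simpa using ((hasDerivWithinAt_id t (Set.Ico 0 T)).const_mul
      (onY (-(3 * π / P₀ ^ 2)) i)).const_add (![P₀, E₀, Y₀] i)
  · intro T' _ y hy t ht
    have hd (s : ℝ) (hs : s ∈ Set.Ico 0 T') (i : Fin 3) :
        HasDerivWithinAt (fun s => y s i) (onY (-(3 * π / y s 0 ^ 2)) i) (Set.Ico 0 T') s := by
      obtain ⟨hD, h⟩ := hy.2 s hs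
      refine (hasDerivWithinAt_pi.1 h i).congr_deriv ?_
      rw [averagedField, avg_f hD.1.ne' hD.2.1.ne', onY]
    have h0 (s : ℝ) (hs : s ∈ Set.Ico 0 T') : y s 0 = P₀ := by
      have := eq_of_hasDerivWithinAt_zero (g := fun s => y s 0) (fun s hs => hd s hs 0) hs
      simpa [hy.1] using this
    have hlin (s : ℝ) (hs : s ∈ Set.Ico 0 T') (i : Fin 3) :
        HasDerivWithinAt (fun s => y s i - onY (-(3 * π / P₀ ^ 2)) i * s) 0 (Set.Ico 0 T') s := by
      have h := hd s hs i
      rw [h0 s hs] at h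
      exact (h.sub ((hasDerivWithinAt_id s (Set.Ico 0 T')).const_mul
        (onY (-(3 * π / P₀ ^ 2)) i))).congr_deriv (by simp)
    ext i
    have := eq_of_hasDerivWithinAt_zero (fun s hs => hlin s hs i) ht
    rw [J_apply, ← hy.1]
    simp only [mul_zero, sub_zero] at this
    linarith

end PolarJ2

open PolarJ2

theorem mainTheorem1
    (P₀ E₀ Y₀ ε U : ℝ) (hP₀ : 0 < P₀) (hE₀ : 0 < E₀) (hE₀' : E₀ < 1) (hε : 0 < ε) (hU : 0 < U)
    (R : ℝ → Mat) (hR : IsR P₀ E₀ Y₀ U R)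
    (K : ℝ → Vec) (hK : IsK P₀ E₀ Y₀ U K)
    (a₀ : ℝ → Vec) (ha₀ : ContDiffOn ℝ 2 a₀ (Set.Ico 0 U))
    (ha₀_bound : ∀ τ ∈ Set.Ico 0 U, ∀ θ : ℝ, ∀ i,
      |(sAux f (PolarJ2.J P₀ E₀ Y₀ τ) θ - (R τ).mulVec (sAux f ![P₀, E₀, Y₀] 0) - K τ) i| ≤ a₀ τ i)
    (ℓ₀ : Vec) (hℓ₀ : α P₀ E₀ ε a₀ 0 (ε • ℓ₀) = ℓ₀)
    (m n : ℝ → Vec)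
    (hmn : SolvesEstimatorSystem P₀ E₀ ε U a₀ ℓ₀ m n)
    (hdom : MeetsDomainConditions P₀ E₀ ε U a₀ n) :
    (∀ T : ℝ, IsTheSolutionOn actionDomain averagedField ![P₀, E₀, Y₀] T
      (PolarJ2.J P₀ E₀ Y₀)) ∧
    ∃ I : ℝ → Vec,
      IsTheSolutionOn actionDomain (satelliteField ε) ![P₀, E₀, Y₀] (U / ε) I ∧
      ∀ t ∈ Set.Ico 0 (U / ε),
        |I t 0 - P₀| ≤ ε * n (ε * t) 0 ∧
        |I t 1 - E₀| ≤ ε * n (ε * t) 1 ∧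
        |I t 2 - (Y₀ - 3 * Real.pi / P₀ ^ 2 * (ε * t))| ≤ ε * n (ε * t) 2 := by
  have H : EstimatorData P₀ E₀ Y₀ ε U R K a₀ ℓ₀ m n :=
    ⟨hP₀, hE₀, hE₀', hε, hR, hK, ha₀, ha₀_bound, hℓ₀, hmn, hdom⟩
  refine ⟨J_isTheSolutionOn hP₀ hE₀ hE₀', ?_⟩
  obtain ⟨I, hI, hle⟩ := H.exists_isTheSolutionOn hU
  refine ⟨I, hI, fun t ht => ⟨hle t ht 0, hle t ht 1, ?_⟩⟩
  exact hle t ht 2
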